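/- Conventions. A connected, simply connected real Lie group $G$ with Lie algebra $\mathfrak g$ is called almost abelian if $\mathfrak g$ has an abelian ideal of codimension one, and non-nilpotent if $\mathfrak g$ is not nilpotent. A left-invariant complex structure on $G$ is a smooth field $J$ of endomorphisms of the tangent spaces of $G$ with $J^2=-\mathrm{Id}$, invariant under left translations and integrable, i.e. with $[JX,JY]-J[JX,Y]-J[X,JY]-[X,Y]=0$ for all smooth vector fields $X,Y$. A complex structure on a real Lie algebra is a linear endomorphism $J$ with $J^2=-\mathrm{Id}$ satisfying the same identity for all elements $X,Y$ of the Lie algebra. The notation $(\alpha_1,\dots,\alpha_6)$ denotes the six-dimensional real Lie algebra with a basis $f_1,\dots,f_6$ whose dual basis $f^1,\dots,f^6$ satisfies $df^k=\alpha_k$, where $f^{ij}=f^i\wedge f^j$ and $df^k(X,Y)=-f^k([X,Y])$. Parameters are real numbers. Theorem. Let $G$ be a six-dimensional, connected and simply connected, non-nilpotent almost abelian Lie group. Then $G$ admits a left-invariant complex structure if and only if its Lie algebra is isomorphic to one of the following Lie algebras (with the stated ranges of the parameters): - $\mathfrak{k}_1^{p,r}=(f^{16},pf^{26},pf^{36},rf^{46},rf^{56},0)$,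 $1\ge|p|\ge|r|>0$; - $\mathfrak{k}_2^{q,r}=(f^{16},f^{26},qf^{36},rf^{46},rf^{56},0)$, $1>|q|\ge|r|>0$; - $\mathfrak{k}_3^{q,s}=(f^{16},f^{26},qf^{36},qf^{46},sf^{56},0)$, $1\ge|q|>|s|>0$; - $\mathfrak{k}_4^{q}=(f^{16},f^{26}+f^{36},f^{36},qf^{46},qf^{56},0)$, $1\ge|q|>0$; - $\mathfrak{k}_5^{p}=(f^{16},pf^{26}+f^{36},pf^{36},f^{46},pf^{56},0)$, $1>|p|>0$; - $\mathfrak{k}_6^{p}=(f^{16},pf^{26}+f^{36},pf^{36},pf^{46}+f^{56},pf^{56},0)$; - $\mathfrak{k}_7^{p}=(pf^{16}+f^{26},pf^{26}+f^{36},pf^{36},pf^{46}+f^{56},pf^{56},0)$, $p\ne0$; - $\mathfrak{k}_8^{p,q,s}=(pf^{16},qf^{26},qf^{36},sf^{46}+f^{56},-f^{46}+sf^{56},0)$, $|p|\ge|q|>0$; - $\mathfrak{k}_9^{p,r,s}=(pf^{16},pf^{26},rf^{36},sf^{46}+f^{56},-f^{46}+sf^{56},0)$, $|p|>|r|>0$;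 - $\mathfrak{k}_{10}^{p,r}=(pf^{16},pf^{26}+f^{36},pf^{36},rf^{46}+f^{56},-f^{46}+rf^{56},0)$, $p\ne0$; - $\mathfrak{k}_{11}^{p,q,r,s}=(pf^{16},qf^{26}+f^{36},-f^{26}+qf^{36},rf^{46}+sf^{56},-sf^{46}+rf^{56},0)$, $ps\ne0$, and $|q|>|r|$ or ($|q|=|r|$ and $|s|\le1$); - $\mathfrak{k}_{12}^{p,q}=(pf^{16},qf^{26}+f^{36}-f^{46},-f^{26}+qf^{36}-f^{56},qf^{46}+f^{56},-f^{46}+qf^{56},0)$, $p\ne0$; - $\mathfrak{k}_{13}=(f^{16},0,0,0,0,0)$; - $\mathfrak{k}_{14}=(f^{16},f^{26},0,0,0,0)$; - $\mathfrak{k}_{15}^p=(pf^{16}+f^{26},-f^{16}+pf^{26},0,0,0,0)$; - $\mathfrak{k}_{16}=(f^{16},f^{26}+f^{36},f^{36},0,0,0)$; - $\mathfrak{k}_{17}^p=(f^{16},pf^{26},pf^{36},0,0,0)$, $1\ge|p|>0$; - $\mathfrak{k}_{18}^q=(f^{16},f^{26},qf^{36},0,0,0)$, $1>|q|>0$; -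 $\mathfrak{k}_{19}^{p,q}=(pf^{16},qf^{26}+f^{36},-f^{26}+qf^{36},0,0,0)$, $p\ne0$; - $\mathfrak{k}_{20}^q=(f^{16},f^{26},qf^{36},qf^{46},0,0)$, $1\ge|q|>0$; - $\mathfrak{k}_{21}=(f^{16},f^{26},f^{46},0,0,0)$; - $\mathfrak{k}_{22}^{q,r}=(f^{16},f^{26},qf^{36}+rf^{46},-rf^{36}+qf^{46},0,0)$, $r\ne0$; - $\mathfrak{k}_{23}^p=(pf^{16}+f^{26},-f^{16}+pf^{26},f^{46},0,0,0)$; - $\mathfrak{k}_{24}=(f^{16}+f^{26},f^{26},f^{36}+f^{46},f^{46},0,0)$; - $\mathfrak{k}_{25}^{p,q,r}=(pf^{16}+f^{26},-f^{16}+pf^{26},qf^{36}+rf^{46},-rf^{36}+qf^{46},0,0)$, $r\ne0$, and $|p|>|q|$ or ($|p|=|q|$ and $|r|\le1$); - $\mathfrak{k}_{26}^p=(pf^{16}+f^{26}-f^{36},-f^{16}+pf^{26}-f^{46},pf^{36}+f^{46},-f^{36}+pf^{46},0,0)$. Moreover, the following endomorphisms $J$ (completed by $J^2=-\mathrm{Id}$)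 are complex structures on these Lie algebras, for all parameters in the stated ranges: - $Jf_1=f_6,\ Jf_2=f_3,\ Jf_4=f_5$ on $\mathfrak k_1,\mathfrak k_8,\mathfrak k_{11},\mathfrak k_{12},\mathfrak k_{13},\mathfrak k_{17},\mathfrak k_{19}$; - $Jf_1=f_2,\ Jf_3=f_6,\ Jf_4=f_5$ on $\mathfrak k_2,\mathfrak k_9,\mathfrak k_{18}$; - $Jf_1=f_2,\ Jf_3=f_4,\ Jf_5=f_6$ on $\mathfrak k_3,\mathfrak k_{14},\mathfrak k_{15},\mathfrak k_{20},\mathfrak k_{22},\mathfrak k_{25},\mathfrak k_{26}$; - $Jf_2=f_1,\ Jf_3=f_6,\ Jf_4=f_5$ on $\mathfrak k_4,\mathfrak k_{10},\mathfrak k_{16}$; - $Jf_1=f_4,\ Jf_2=f_5,\ Jf_3=f_6$ on $\mathfrak k_5,\mathfrak k_7$; - $Jf_1=f_6,\ Jf_2=f_4,\ Jf_3=f_5$ on $\mathfrak k_6$; - $Jf_1=f_2,\ Jf_3=f_5,\ Jf_4=f_6$ on $\mathfrak k_{21},\mathfrak k_{23}$; - $Jf_1=f_3,\ Jf_2=f_4,\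 Jf_5=f_6$ on $\mathfrak k_{24}$. -/

import Mathlib

open scoped Manifold ContDiff

namespace AlmostAbelianSix

noncomputable section

/-! ### Lie algebras: codimension-one abelian ideals and complex structures -/

/-- A finite-dimensional real Lie algebra is almost abelian if it has an abelian ideal of
codimension one. -/
def IsAlmostAbelian (L : Type*) [LieRing L] [LieAlgebra ℝ L] : Prop :=
  ∃ I : LieIdeal ℝ L, IsLieAbelian I ∧ Module.finrank ℝ I + 1 = Module.finrank ℝ L

/-- A complex structure on a real Lie algebra: a linear endomorphism `J` with `J ^ 2 = -1` whose
Nijenhuis tensor `[Jx, Jy] - J[Jx, y] - J[x, Jy] - [x, y]` vanishes. -/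
structure IsComplexStructure (L : Type*) [LieRing L] [LieAlgebra ℝ L] (J : L →ₗ[ℝ] L) :
    Prop where
  sq_eq_neg : ∀ x : L, J (J x) = -x
  nijenhuis_eq_zero : ∀ x y : L, ⁅J x, J y⁆ - J ⁅J x, y⁆ - J ⁅x, J y⁆ - ⁅x, y⁆ = 0

/-! ### Left-invariant complex structures on Lie groups -/

/-- Smooth real Lie groups satisfy the finite order of smoothness that Mathlib asks for in order
to define the Lie bracket on the tangent space at the identity. -/
instance instLEInftyMinSmoothness : ENat.LEInfty (minSmoothness ℝ 3) where
  out := by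
    rw [minSmoothness_of_isRCLikeNormedField]
    exact ENat.LEInfty.out

/-- A left-invariant complex structure on a six-dimensional Lie group: a smooth field `J` of
endomorphisms of the tangent spaces (it maps smooth vector fields to smooth vector fields) with
`J ^ 2 = -1`, which is integrable (its Nijenhuis tensor vanishes on all smooth vector fields)
and invariant under the differentials of all left translations. -/
structure IsLeftInvariantComplexStructure (G : Type*) [TopologicalSpace G]
    [ChartedSpace (EuclideanSpace ℝ (Fin 6)) G] [Group G] [LieGroup (𝓡 6) ∞ G]
    (J : ∀ g : G, TangentSpace (𝓡 6) g →ₗ[ℝ] TangentSpace (𝓡 6) g) : Prop where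
  smooth : ∀ X : (∀ g : G, TangentSpace (𝓡 6) g),
    ContMDiff (𝓡 6) (𝓡 6).tangent ∞ (fun g : G => (⟨g, X g⟩ : TangentBundle (𝓡 6) G)) →
    ContMDiff (𝓡 6) (𝓡 6).tangent ∞ (fun g : G => (⟨g, J g (X g)⟩ : TangentBundle (𝓡 6) G))
  sq_eq_neg : ∀ (g : G) (v : TangentSpace (𝓡 6) g), J g (J g v) = -v
  nijenhuis_eq_zero : ∀ X Y : (∀ g : G, TangentSpace (𝓡 6) g),
    ContMDiff (𝓡 6) (𝓡 6).tangent ∞ (fun g : G => (⟨g, X g⟩ : TangentBundle (𝓡 6) G)) →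
    ContMDiff (𝓡 6) (𝓡 6).tangent ∞ (fun g : G => (⟨g, Y g⟩ : TangentBundle (𝓡 6) G)) →
    ∀ g : G,
      VectorField.mlieBracket (𝓡 6) (fun h => J h (X h)) (fun h => J h (Y h)) g
        - J g (VectorField.mlieBracket (𝓡 6) (fun h => J h (X h)) Y g)
        - J g (VectorField.mlieBracket (𝓡 6) X (fun h => J h (Y h)) g)
        - VectorField.mlieBracket (𝓡 6) X Y g = 0
  left_invariant : ∀ (g h : G) (v : TangentSpace (𝓡 6) h),
    J (g * h) (mfderiv (𝓡 6) (𝓡 6) (fun x : G => g * x) h v)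
      = mfderiv (𝓡 6) (𝓡 6) (fun x : G => g * x) h (J h v)

/-! ### Lie algebras given by structure equations `df^k = ∑ j, B k j • f^j ∧ f^6`, `df^6 = 0` -/

/-- The value at `(x, y)` of the 2-form `f^j ∧ f^6`, where `f^1, …, f^6` are the coordinate forms
of `ℝ^6`. The indices `1, …, 6` are represented by `0, …, 5`. -/
def wedgeSix (j : Fin 6) (x y : Fin 6 → ℝ) : ℝ := x j * y 5 - x 5 * y j

/-- The values at `(x, y)` of the 2-forms `df^1, …, df^6`, where `df^k = ∑ j, B k j • f^j ∧ f^6`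
for `k ≤ 5` and `df^6 = 0`. -/
def dForm (B : Matrix (Fin 5) (Fin 5) ℝ) (x y : Fin 6 → ℝ) : Fin 6 → ℝ :=
  Fin.snoc (α := fun _ => ℝ) (fun k : Fin 5 => ∑ j : Fin 5, B k j * wedgeSix j.castSucc x y) 0

/-- The six-dimensional real Lie algebra with basis `f_1, …, f_6` whose dual basis satisfies the
structure equations `df^k = ∑ j, B k j • f^j ∧ f^6` for `k ≤ 5` and `df^6 = 0`. It is
`ℝ^6` as a vector space. -/
def Alg (_B : Matrix (Fin 5) (Fin 5) ℝ) : Type := Fin 6 → ℝ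

variable {B : Matrix (Fin 5) (Fin 5) ℝ}

instance : AddCommGroup (Alg B) := inferInstanceAs (AddCommGroup (Fin 6 → ℝ))

instance : Module ℝ (Alg B) := inferInstanceAs (Module ℝ (Fin 6 → ℝ))

/-- The bracket is determined by `f^k([x, y]) = -df^k(x, y)`. -/
instance : Bracket (Alg B) (Alg B) where
  bracket x y := fun k => -dForm B x y k

theorem Alg.bracket_castSucc (x y : Alg B) (k : Fin 5) :
    (⁅x, y⁆ : Alg B) k.castSucc =
      -∑ j : Fin 5, B k j * (x j.castSucc * y 5 - x 5 * y j.castSucc) := by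
  change -dForm B x y k.castSucc = _
  simp only [dForm, wedgeSix, Fin.snoc_castSucc]

theorem Alg.bracket_five (x y : Alg B) : (⁅x, y⁆ : Alg B) 5 = 0 := by
  change -dForm B x y (Fin.last 5) = _
  simp only [dForm, Fin.snoc_last, neg_zero]

theorem Alg.ext_castSucc {x y : Alg B} (h : ∀ k : Fin 5, x k.castSucc = y k.castSucc)
    (h5 : x 5 = y 5) : x = y :=
  funext fun i => Fin.lastCases (motive := fun i => x i = y i) h5 h i

theorem Alg.add_apply (x y : Alg B) (i : Fin 6) : (x + y) i = x i + y i := rfl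

theorem Alg.smul_apply (c : ℝ) (x : Alg B) (i : Fin 6) : (c • x) i = c * x i := rfl

instance : LieRing (Alg B) where
  add_lie x y z := by
    refine Alg.ext_castSucc (fun k => ?_) ?_
    · simp only [Alg.add_apply, Alg.bracket_castSucc, ← neg_add, ← Finset.sum_add_distrib]
      exact congrArg _ (Finset.sum_congr rfl fun j _ => by ring)
    · simp only [Alg.add_apply, Alg.bracket_five, add_zero]
  lie_add x y z := by
    refine Alg.ext_castSucc (fun k => ?_) ?_
    · simp only [Alg.add_apply, Alg.bracket_castSucc, ← neg_add, ← Finset.sum_add_distrib]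
      exact congrArg _ (Finset.sum_congr rfl fun j _ => by ring)
    · simp only [Alg.add_apply, Alg.bracket_five, add_zero]
  lie_self x := by
    refine Alg.ext_castSucc (fun k => ?_) ?_
    · rw [Alg.bracket_castSucc]
      change _ = (0 : ℝ)
      rw [neg_eq_zero]
      exact Finset.sum_eq_zero fun j _ => by ring
    · rw [Alg.bracket_five]
      rfl
  leibniz_lie x y z := by
    refine Alg.ext_castSucc (fun k => ?_) ?_
    · simp only [Alg.add_apply, Alg.bracket_castSucc, Alg.bracket_five, ← neg_add,
        ← Finset.sum_add_distrib]
      refine congrArg _ ?_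
      simp only [mul_zero, zero_mul, zero_sub, sub_zero, mul_neg, neg_mul, neg_neg,
        Finset.mul_sum, Finset.sum_mul, ← Finset.sum_neg_distrib, ← Finset.sum_add_distrib]
      exact Finset.sum_congr rfl fun j _ => Finset.sum_congr rfl fun i _ => by ring
    · simp only [Alg.add_apply, Alg.bracket_five, add_zero]

instance : LieAlgebra ℝ (Alg B) where
  lie_smul c x y := by
    refine Alg.ext_castSucc (fun k => ?_) ?_
    · simp only [Alg.smul_apply, Alg.bracket_castSucc, mul_neg, Finset.mul_sum]
      exact congrArg _ (Finset.sum_congr rfl fun j _ => by ring)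
    · simp only [Alg.smul_apply, Alg.bracket_five, mul_zero]

/-- The basis vector `f_{i+1}` (so `basisVec 0 = f_1`, …, `basisVec 5 = f_6`). -/
def basisVec (i : Fin 6) : Alg B := (Pi.single i 1 : Fin 6 → ℝ)

/-- The endomorphism with `f_a ↦ f_b` and `f_b ↦ -f_a`, and zero on the other basis vectors. -/
def pairMap (a b : Fin 6) : Alg B →ₗ[ℝ] Alg B where
  toFun x := x a • basisVec b - x b • basisVec a
  map_add' x y := by
    simp only [Alg.add_apply, add_smul]
    abel
  map_smul' c x := by
    simp only [Alg.smul_apply, mul_smul, smul_sub, RingHom.id_apply]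

/-- For `{a₁, b₁, a₂, b₂, a₃, b₃}` the six indices `1, …, 6` in some order, the almost complex
structure with `J f_{a₁} = f_{b₁}`, `J f_{a₂} = f_{b₂}`, `J f_{a₃} = f_{b₃}` (hence
`J f_{bᵢ} = -f_{aᵢ}`). The indices are given as the numbers `1, …, 6`. -/
def stdJ (a₁ b₁ a₂ b₂ a₃ b₃ : ℕ) : Alg B →ₗ[ℝ] Alg B :=
  pairMap (Fin.ofNat 6 (a₁ - 1)) (Fin.ofNat 6 (b₁ - 1))
    + pairMap (Fin.ofNat 6 (a₂ - 1)) (Fin.ofNat 6 (b₂ - 1))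
    + pairMap (Fin.ofNat 6 (a₃ - 1)) (Fin.ofNat 6 (b₃ - 1))

/-! ### The 26 families -/

/-- The names of the 26 families, with real parameters. -/
inductive Family : Type
  | k1 (p r : ℝ)
  | k2 (q r : ℝ)
  | k3 (q s : ℝ)
  | k4 (q : ℝ)
  | k5 (p : ℝ)
  | k6 (p : ℝ)
  | k7 (p : ℝ)
  | k8 (p q s : ℝ)
  | k9 (p r s : ℝ)
  | k10 (p r : ℝ)
  | k11 (p q r s : ℝ)
  | k12 (p q : ℝ)
  | k13
  | k14
  | k15 (p : ℝ)
  | k16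
  | k17 (p : ℝ)
  | k18 (q : ℝ)
  | k19 (p q : ℝ)
  | k20 (q : ℝ)
  | k21
  | k22 (q r : ℝ)
  | k23 (p : ℝ)
  | k24
  | k25 (p q r : ℝ)
  | k26 (p : ℝ)

namespace Family

/-- The range of the parameters of each family. -/
def InRange : Family → Prop
  | k1 p r => 1 ≥ |p| ∧ |p| ≥ |r| ∧ |r| > 0
  | k2 q r => 1 > |q| ∧ |q| ≥ |r| ∧ |r| > 0
  | k3 q s => 1 ≥ |q| ∧ |q| > |s| ∧ |s| > 0
  | k4 q => 1 ≥ |q| ∧ |q| > 0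
  | k5 p => 1 > |p| ∧ |p| > 0
  | k6 _ => True
  | k7 p => p ≠ 0
  | k8 p q _ => |p| ≥ |q| ∧ |q| > 0
  | k9 p r _ => |p| > |r| ∧ |r| > 0
  | k10 p _ => p ≠ 0
  | k11 p q r s => p * s ≠ 0 ∧ (|q| > |r| ∨ (|q| = |r| ∧ |s| ≤ 1))
  | k12 p _ => p ≠ 0
  | k13 => True
  | k14 => True
  | k15 _ => True
  | k16 => True
  | k17 p => 1 ≥ |p| ∧ |p| > 0
  | k18 q => 1 > |q| ∧ |q| > 0
  | k19 p _ => p ≠ 0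
  | k20 q => 1 ≥ |q| ∧ |q| > 0
  | k21 => True
  | k22 _ r => r ≠ 0
  | k23 _ => True
  | k24 => True
  | k25 p q r => r ≠ 0 ∧ (|p| > |q| ∨ (|p| = |q| ∧ |r| ≤ 1))
  | k26 _ => True

/-- The coefficients of the structure equations: the `k`-th row lists the coefficients of
`f^{16}, f^{26}, f^{36}, f^{46}, f^{56}` in `df^k`, for `k = 1, …, 5`. -/
def coeff : Family → Matrix (Fin 5) (Fin 5) ℝ
  | k1 p r => !![1, 0, 0, 0, 0; 0, p, 0, 0, 0; 0, 0, p, 0, 0; 0, 0, 0, r, 0; 0, 0, 0, 0, r]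
  | k2 q r => !![1, 0, 0, 0, 0; 0, 1, 0, 0, 0; 0, 0, q, 0, 0; 0, 0, 0, r, 0; 0, 0, 0, 0, r]
  | k3 q s => !![1, 0, 0, 0, 0; 0, 1, 0, 0, 0; 0, 0, q, 0, 0; 0, 0, 0, q, 0; 0, 0, 0, 0, s]
  | k4 q => !![1, 0, 0, 0, 0; 0, 1, 1, 0, 0; 0, 0, 1, 0, 0; 0, 0, 0, q, 0; 0, 0, 0, 0, q]
  | k5 p => !![1, 0, 0, 0, 0; 0, p, 1, 0, 0; 0, 0, p, 0, 0; 0, 0, 0, 1, 0; 0, 0, 0, 0, p]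
  | k6 p => !![1, 0, 0, 0, 0; 0, p, 1, 0, 0; 0, 0, p, 0, 0; 0, 0, 0, p, 1; 0, 0, 0, 0, p]
  | k7 p => !![p, 1, 0, 0, 0; 0, p, 1, 0, 0; 0, 0, p, 0, 0; 0, 0, 0, p, 1; 0, 0, 0, 0, p]
  | k8 p q s => !![p, 0, 0, 0, 0; 0, q, 0, 0, 0; 0, 0, q, 0, 0; 0, 0, 0, s, 1; 0, 0, 0, -1, s]
  | k9 p r s => !![p, 0, 0, 0, 0; 0, p, 0, 0, 0; 0, 0, r, 0, 0; 0, 0, 0, s, 1; 0, 0, 0, -1, s]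
  | k10 p r => !![p, 0, 0, 0, 0; 0, p, 1, 0, 0; 0, 0, p, 0, 0; 0, 0, 0, r, 1; 0, 0, 0, -1, r]
  | k11 p q r s =>
      !![p, 0, 0, 0, 0; 0, q, 1, 0, 0; 0, -1, q, 0, 0; 0, 0, 0, r, s; 0, 0, 0, -s, r]
  | k12 p q =>
      !![p, 0, 0, 0, 0; 0, q, 1, -1, 0; 0, -1, q, 0, -1; 0, 0, 0, q, 1; 0, 0, 0, -1, q]
  | k13 => !![1, 0, 0, 0, 0; 0, 0, 0, 0, 0; 0, 0, 0, 0, 0; 0, 0, 0, 0, 0; 0, 0, 0, 0, 0]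
  | k14 => !![1, 0, 0, 0, 0; 0, 1, 0, 0, 0; 0, 0, 0, 0, 0; 0, 0, 0, 0, 0; 0, 0, 0, 0, 0]
  | k15 p => !![p, 1, 0, 0, 0; -1, p, 0, 0, 0; 0, 0, 0, 0, 0; 0, 0, 0, 0, 0; 0, 0, 0, 0, 0]
  | k16 => !![1, 0, 0, 0, 0; 0, 1, 1, 0, 0; 0, 0, 1, 0, 0; 0, 0, 0, 0, 0; 0, 0, 0, 0, 0]
  | k17 p => !![1, 0, 0, 0, 0; 0, p, 0, 0, 0; 0, 0, p, 0, 0; 0, 0, 0, 0, 0; 0, 0, 0, 0, 0]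
  | k18 q => !![1, 0, 0, 0, 0; 0, 1, 0, 0, 0; 0, 0, q, 0, 0; 0, 0, 0, 0, 0; 0, 0, 0, 0, 0]
  | k19 p q => !![p, 0, 0, 0, 0; 0, q, 1, 0, 0; 0, -1, q, 0, 0; 0, 0, 0, 0, 0; 0, 0, 0, 0, 0]
  | k20 q => !![1, 0, 0, 0, 0; 0, 1, 0, 0, 0; 0, 0, q, 0, 0; 0, 0, 0, q, 0; 0, 0, 0, 0, 0]
  | k21 => !![1, 0, 0, 0, 0; 0, 1, 0, 0, 0; 0, 0, 0, 1, 0; 0, 0, 0, 0, 0; 0, 0, 0, 0, 0]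
  | k22 q r => !![1, 0, 0, 0, 0; 0, 1, 0, 0, 0; 0, 0, q, r, 0; 0, 0, -r, q, 0; 0, 0, 0, 0, 0]
  | k23 p => !![p, 1, 0, 0, 0; -1, p, 0, 0, 0; 0, 0, 0, 1, 0; 0, 0, 0, 0, 0; 0, 0, 0, 0, 0]
  | k24 => !![1, 1, 0, 0, 0; 0, 1, 0, 0, 0; 0, 0, 1, 1, 0; 0, 0, 0, 1, 0; 0, 0, 0, 0, 0]
  | k25 p q r =>
      !![p, 1, 0, 0, 0; -1, p, 0, 0, 0; 0, 0, q, r, 0; 0, 0, -r, q, 0; 0, 0, 0, 0, 0]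
  | k26 p =>
      !![p, 1, -1, 0, 0; -1, p, 0, -1, 0; 0, 0, p, 1, 0; 0, 0, -1, p, 0; 0, 0, 0, 0, 0]

/-- The Lie algebra of a family, for given values of the parameters. -/
abbrev algebra (k : Family) : Type := Alg k.coeff

/-- The explicit complex structure on each Lie algebra of the list. For instance
`stdJ 1 6 2 3 4 5` is `J f_1 = f_6`, `J f_2 = f_3`, `J f_4 = f_5`. -/
def complexStructure (k : Family) : k.algebra →ₗ[ℝ] k.algebra :=
  match k with
  | k1 _ _ => stdJ 1 6 2 3 4 5
  | k2 _ _ => stdJ 1 2 3 6 4 5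
  | k3 _ _ => stdJ 1 2 3 4 5 6
  | k4 _ => stdJ 2 1 3 6 4 5
  | k5 _ => stdJ 1 4 2 5 3 6
  | k6 _ => stdJ 1 6 2 4 3 5
  | k7 _ => stdJ 1 4 2 5 3 6
  | k8 _ _ _ => stdJ 1 6 2 3 4 5
  | k9 _ _ _ => stdJ 1 2 3 6 4 5
  | k10 _ _ => stdJ 2 1 3 6 4 5
  | k11 _ _ _ _ => stdJ 1 6 2 3 4 5
  | k12 _ _ => stdJ 1 6 2 3 4 5
  | k13 => stdJ 1 6 2 3 4 5
  | k14 => stdJ 1 2 3 4 5 6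
  | k15 _ => stdJ 1 2 3 4 5 6
  | k16 => stdJ 2 1 3 6 4 5
  | k17 _ => stdJ 1 6 2 3 4 5
  | k18 _ => stdJ 1 2 3 6 4 5
  | k19 _ _ => stdJ 1 6 2 3 4 5
  | k20 _ => stdJ 1 2 3 4 5 6
  | k21 => stdJ 1 2 3 5 4 6
  | k22 _ _ => stdJ 1 2 3 4 5 6
  | k23 _ => stdJ 1 2 3 5 4 6
  | k24 => stdJ 1 3 2 4 5 6
  | k25 _ _ _ => stdJ 1 2 3 4 5 6
  | k26 _ => stdJ 1 2 3 4 5 6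

end Family

end

end AlmostAbelianSix

/-! A left-invariant complex structure on `G` is the same as a complex structure on its Lie algebra
(`exists_isLeftInvariantComplexStructure_iff`). Restricting to the identity is easy. Conversely, an
endomorphism `J` of the Lie algebra is spread over `G` by left translations; the field obtained is
smooth because it is a composition of smooth maps of the tangent bundle (the Maurer–Cartan form,
`J`, and left translation), and its Nijenhuis tensor, being tensorial, vanishes because it vanishes on
left-invariant fields.

Let `L` be a six-dimensional Lie algebra with an abelian ideal `I` of dimension five and a complex
structure `J`, and view `L` as a complex vector space. As `I` has odd dimension, some `e ∈ I` has
`i e ∉ I`, and `L = W ⊕ ℂ e`, where `W = I ∩ i I` is a complex plane. Integrability says exactly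
that `ad (i e)` preserves `W` and is complex linear there. Hence the real endomorphism `ad (i e)` of
`I` consists of a complex `2 × 2` matrix and one more real eigenvalue `a`, with
`[i e, e] = a e + v` for some `v ∈ W`. Putting the matrix in Jordan form and then absorbing as much
of `v` as possible into `e` leaves four shapes (`exists_extension_normalForm`,
`exists_lieEquiv_modelMatrix`):

* the matrix is diagonal and `v = 0`;
* the matrix is diagonal and `v` is an eigenvector with eigenvalue `a`;
* the matrix is a Jordan block and `v = 0`;
* the matrix is a Jordan block with eigenvalue `a` and `v` generates it.

In each shape, one rescales `i e` and permutes and rescales the basis of `I`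
(`nonempty_lieEquiv_of_monomial`) to reach one of the 26 families; which one depends on the order of
the absolute values of the eigenvalues and on which of them are real or zero. If all eigenvalues
vanish then `L` is nilpotent by Engel's theorem.

Conversely, the explicit `J` on each family are complex structures
(`Family.isComplexStructure`) and are transported to `L` by an isomorphism. -/

namespace AlmostAbelianSix

noncomputable section

/-! ### Left-invariant complex structures and the Lie algebra -/

section LieGroup

open Bundle VectorField

variable {E : Type*} [NormedAddCommGroup E] [NormedSpace ℝ E] {H : Type*} [TopologicalSpace H]
  {I : ModelWithCorners ℝ E H} {G : Type*} [TopologicalSpace G] [ChartedSpace H G] [Group G]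

variable (I) in
/-- The differential at `x` of the left translation by `g`. The tangent spaces of `G` are all
(by definition) the model space `E`, and the type does not record the base points, so that base
points such as `g * 1` and `g` may be rewritten into each other. -/
def leftDeriv (g x : G) : E →L[ℝ] E := mfderiv I I (fun y : G => g * y) x

theorem leftDeriv_one (x : G) (v : E) : leftDeriv I (1 : G) x v = v := by
  have h : (fun y : G => 1 * y) = id := funext fun y => one_mul y
  unfold leftDeriv
  rw [h, mfderiv_id]
  rfl

variable [LieGroup I ∞ G]

theorem mdifferentiable_mul_left_infty (g : G) : MDifferentiable I I (fun y : G => g * y) :=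
  (contMDiff_mul_left (I := I) (n := ∞)).mdifferentiable (by simp)

theorem leftDeriv_leftDeriv (a b x : G) (v : E) :
    leftDeriv I a (b * x) (leftDeriv I b x v) = leftDeriv I (a * b) x v := by
  have h : (fun y : G => a * b * y) = (fun y : G => a * y) ∘ (fun y : G => b * y) :=
    funext fun y => mul_assoc a b y
  unfold leftDeriv
  rw [h, mfderiv_comp (I' := I) x (mdifferentiable_mul_left_infty a _)
    (mdifferentiable_mul_left_infty b _)]
  rfl

/-- Left translation of tangent vectors, `(g, ξ) ↦ dL_g ξ`, is smooth in both variables: it is the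
restriction of the tangent map of the multiplication to the zero section in the first factor. -/
theorem contMDiff_leftTranslate {M : Type*} [TopologicalSpace M] {EM : Type*}
    [NormedAddCommGroup EM] [NormedSpace ℝ EM] {HM : Type*} [TopologicalSpace HM]
    [ChartedSpace HM M] {IM : ModelWithCorners ℝ EM HM} {f : M → G}
    {ξ : M → TangentBundle I G} (hf : ContMDiff IM I ∞ f) (hξ : ContMDiff IM I.tangent ∞ ξ) :
    ContMDiff IM I.tangent ∞
      (fun m =>
        (⟨f m * (ξ m).proj, leftDeriv I (f m) (ξ m).proj (ξ m).2⟩ : TangentBundle I G)) := by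
  have S₀ : ContMDiff IM I.tangent ∞ (fun m => zeroSection E (TangentSpace I : G → Type _) (f m)) :=
    (contMDiff_zeroSection ℝ (TangentSpace I : G → Type _)).comp hf
  have S₁ := S₀.prodMk hξ
  have S₂ := (contMDiff_equivTangentBundleProd_symm (I := I) (M := G) (I' := I) (M' := G)
    (n := ∞)).comp S₁
  have S₃ : ContMDiff (I.prod I).tangent I.tangent ∞
      (tangentMap (I.prod I) I (fun p : G × G => p.1 * p.2)) :=
    ContMDiff.contMDiff_tangentMap (contMDiff_mul I ∞) (m := ∞) (by simp)
  refine (S₃.comp S₂).congr fun m => ?_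
  simp only [Function.comp_apply, tangentMap]
  rw [mfderiv_prod_eq_add_apply ((contMDiff_mul I ∞).mdifferentiable (by simp) _)]
  refine congrArg (fun v : E => (⟨f m * (ξ m).proj, v⟩ : TangentBundle I G)) ?_
  have h0 : (mfderiv I I (fun y : G => y * (ξ m).proj) (f m) : E →L[ℝ] E) (0 : E) = (0 : E) :=
    map_zero _
  exact ((congrArg (fun v : E => v + leftDeriv I (f m) (ξ m).proj (ξ m).2) h0).trans
    (zero_add _)).symm

/-- The Maurer–Cartan form of `G` on the tangent space at `g`: translate a tangent vector back to
the identity. -/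
def maurerCartan (g : G) : E →L[ℝ] E := leftDeriv I g⁻¹ g

theorem maurerCartan_leftDeriv_one (g : G) (v : E) :
    maurerCartan (I := I) g (leftDeriv I g 1 v) = v := by
  have h := leftDeriv_leftDeriv (I := I) g⁻¹ g 1 v
  rw [mul_one, inv_mul_cancel, leftDeriv_one] at h
  exact h

theorem leftDeriv_one_maurerCartan (g : G) (v : E) :
    leftDeriv I g 1 (maurerCartan (I := I) g v) = v := by
  have h := leftDeriv_leftDeriv (I := I) g g⁻¹ g v
  rw [inv_mul_cancel, mul_inv_cancel, leftDeriv_one] at h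
  exact h

/-- The Maurer–Cartan form is left-invariant. -/
theorem maurerCartan_leftDeriv (g h : G) (v : E) :
    maurerCartan (I := I) (g * h) (leftDeriv I g h v) = maurerCartan (I := I) h v := by
  have := leftDeriv_leftDeriv (I := I) (g * h)⁻¹ g h v
  rwa [mul_inv_rev, inv_mul_cancel_right, ← mul_inv_rev] at this

omit [Group G] [LieGroup I ∞ G] in
theorem trivializationAt_snd_self [IsManifold I 1 G] (x : G) (v : TangentSpace I x) :
    (trivializationAt E (TangentSpace I) x ⟨x, v⟩).2 = v :=
  (tangentBundleCore I G).coordChange_self (achart H x) x (mem_achart_source H x) v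

/-- The Maurer–Cartan form is smooth, as a function on the tangent bundle. -/
theorem contMDiff_maurerCartan :
    ContMDiff I.tangent 𝓘(ℝ, E) ∞
      (fun ξ : TangentBundle I G => maurerCartan (I := I) ξ.proj ξ.2) := by
  have hp : ContMDiff I.tangent I ∞ (fun ξ : TangentBundle I G => ξ.proj) :=
    Bundle.contMDiff_proj (TangentSpace I : G → Type _)
  have h := contMDiff_leftTranslate ((contMDiff_inv I ∞).comp hp) contMDiff_id
  have h' : ContMDiff I.tangent I.tangent ∞ (fun ξ : TangentBundle I G =>
      (⟨1, maurerCartan (I := I) ξ.proj ξ.2⟩ : TangentBundle I G)) := by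
    refine h.congr fun ξ => ?_
    have e : ξ.proj⁻¹ * ξ.proj = 1 := inv_mul_cancel _
    change (⟨1, leftDeriv I ξ.proj⁻¹ ξ.proj ξ.2⟩ : TangentBundle I G) =
      ⟨ξ.proj⁻¹ * ξ.proj, leftDeriv I ξ.proj⁻¹ ξ.proj ξ.2⟩
    exact congrArg (fun g : G => (⟨g, leftDeriv I ξ.proj⁻¹ ξ.proj ξ.2⟩ : TangentBundle I G)) e.symm
  intro ξ
  have h'' := (Bundle.contMDiffAt_totalSpace.mp (h' ξ)).2
  refine h''.congr_of_eventuallyEq (Filter.Eventually.of_forall fun η => ?_)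
  exact (trivializationAt_snd_self (I := I) (1 : G) _).symm

variable (I) in
/-- The left-invariant field of endomorphisms of the tangent spaces that extends a given
endomorphism of the tangent space at the identity. -/
def leftInvariantEnd (J : GroupLieAlgebra I G →ₗ[ℝ] GroupLieAlgebra I G) (g : G) :
    TangentSpace I g →ₗ[ℝ] TangentSpace I g :=
  ((leftDeriv I g 1 : E →ₗ[ℝ] E) ∘ₗ (J : E →ₗ[ℝ] E) ∘ₗ (maurerCartan (I := I) g : E →ₗ[ℝ] E) :
    E →ₗ[ℝ] E)

theorem contMDiff_leftInvariantEnd [FiniteDimensional ℝ E]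
    (J : GroupLieAlgebra I G →ₗ[ℝ] GroupLieAlgebra I G) :
    ContMDiff I.tangent I.tangent ∞
      (fun ξ : TangentBundle I G => (⟨ξ.proj, leftInvariantEnd I J ξ.proj ξ.2⟩ :
        TangentBundle I G)) := by
  have hp : ContMDiff I.tangent I ∞ (fun ξ : TangentBundle I G => ξ.proj) :=
    Bundle.contMDiff_proj (TangentSpace I : G → Type _)
  let J' : E →L[ℝ] E := LinearMap.toContinuousLinearMap (J : E →ₗ[ℝ] E)
  have h₁ : ContMDiff I.tangent 𝓘(ℝ, E) ∞
      (fun ξ : TangentBundle I G => J' (maurerCartan (I := I) ξ.proj ξ.2)) :=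
    J'.contMDiff.comp contMDiff_maurerCartan
  have h₂ : ContMDiff 𝓘(ℝ, E) I.tangent ∞ (fun v : E => (⟨1, v⟩ : TangentBundle I G)) := by
    intro v
    rw [Bundle.contMDiffAt_totalSpace]
    refine ⟨contMDiffAt_const, contMDiffAt_id.congr_of_eventuallyEq
      (Filter.Eventually.of_forall fun w => ?_)⟩
    exact trivializationAt_snd_self (I := I) (1 : G) w
  refine (contMDiff_leftTranslate hp (h₂.comp h₁)).congr fun ξ => ?_
  exact congrArg (fun g : G => (⟨g, leftInvariantEnd I J ξ.proj ξ.2⟩ : TangentBundle I G))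
    (mul_one ξ.proj).symm

theorem leftInvariantEnd_mulInvariantVectorField
    (J : GroupLieAlgebra I G →ₗ[ℝ] GroupLieAlgebra I G) (v : GroupLieAlgebra I G) (g : G) :
    leftInvariantEnd I J g (mulInvariantVectorField v g) = mulInvariantVectorField (J v) g := by
  exact congrArg (fun u : E => leftDeriv I g 1 ((J : E →ₗ[ℝ] E) u))
    (maurerCartan_leftDeriv_one (E := E) g v)

theorem leftInvariantEnd_leftInvariant (J : GroupLieAlgebra I G →ₗ[ℝ] GroupLieAlgebra I G)
    (g h : G) (v : TangentSpace I h) :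
    leftInvariantEnd I J (g * h) (mfderiv I I (fun x : G => g * x) h v)
      = mfderiv I I (fun x : G => g * x) h (leftInvariantEnd I J h v) := by
  have h₁ := congrArg (fun u : E => leftDeriv I (g * h) 1 ((J : E →ₗ[ℝ] E) u))
    (maurerCartan_leftDeriv (E := E) (I := I) g h v)
  have h₂ := leftDeriv_leftDeriv (I := I) g h 1 ((J : E →ₗ[ℝ] E) (maurerCartan (I := I) h v))
  rw [mul_one] at h₂
  exact h₁.trans h₂.symm

/-- Every tangent vector extends to a left-invariant vector field. -/
theorem mulInvariantVectorField_maurerCartan (g : G) (v : TangentSpace I g) :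
    mulInvariantVectorField (maurerCartan (I := I) g v : GroupLieAlgebra I G) g = v :=
  leftDeriv_one_maurerCartan (E := E) g v

omit [Group G] [LieGroup I ∞ G] in
/-- The Nijenhuis tensor of an almost complex structure is tensorial in its first argument. -/
theorem tensorialAt_nijenhuis [CompleteSpace E] [IsManifold I 1 G] [IsManifold I 2 G]
    (J : ∀ g : G, TangentSpace I g →ₗ[ℝ] TangentSpace I g)
    (hJ : ∀ (g : G) (v : TangentSpace I g), J g (J g v) = -v) (x : G)
    (hJd : ∀ X : ∀ g : G, TangentSpace I g,
      MDifferentiableAt I I.tangent (fun g => (⟨g, X g⟩ : TangentBundle I G)) x →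
      MDifferentiableAt I I.tangent (fun g => (⟨g, J g (X g)⟩ : TangentBundle I G)) x)
    (Y : ∀ g : G, TangentSpace I g) :
    TensorialAt I E (fun X : ∀ g : G, TangentSpace I g =>
      mlieBracket I (fun h => J h (X h)) (fun h => J h (Y h)) x
        - J x (mlieBracket I (fun h => J h (X h)) Y x)
        - J x (mlieBracket I X (fun h => J h (Y h)) x)
        - mlieBracket I X Y x) x where
  smul {f X} hf hX := by
    have e : (fun h => J h ((f • X) h)) = f • (fun h => J h (X h)) :=
      funext fun h => (J h).map_smul (f h) (X h)
    simp only [e]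
    rw [mlieBracket_smul_left hf (hJd X hX), mlieBracket_smul_left hf (hJd X hX),
      mlieBracket_smul_left hf hX, mlieBracket_smul_left hf hX]
    simp only [map_add, map_smul, map_neg, hJ, smul_sub, neg_smul, smul_neg]
    abel
  add {X X'} hX hX' := by
    have e : (fun h => J h ((X + X') h)) = (fun h => J h (X h)) + (fun h => J h (X' h)) :=
      funext fun h => (J h).map_add (X h) (X' h)
    simp only [e]
    rw [mlieBracket_add_left (hJd X hX) (hJd X' hX'), mlieBracket_add_left (hJd X hX) (hJd X' hX'),
      mlieBracket_add_left hX hX', mlieBracket_add_left hX hX']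
    simp only [map_add]
    abel

end LieGroup

section SixDimensional

open Bundle VectorField

variable {G : Type*} [TopologicalSpace G] [ChartedSpace (EuclideanSpace ℝ (Fin 6)) G] [Group G]
  [LieGroup (𝓡 6) ∞ G]

omit [Group G] [LieGroup (𝓡 6) ∞ G] in
/-- The Nijenhuis tensor of an almost complex structure changes sign when its arguments are
exchanged. -/
theorem nijenhuis_swap (J : ∀ g : G, TangentSpace (𝓡 6) g →ₗ[ℝ] TangentSpace (𝓡 6) g)
    (X Y : ∀ g : G, TangentSpace (𝓡 6) g) (x : G) :
    mlieBracket (𝓡 6) (fun h => J h (X h)) (fun h => J h (Y h)) x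
        - J x (mlieBracket (𝓡 6) (fun h => J h (X h)) Y x)
        - J x (mlieBracket (𝓡 6) X (fun h => J h (Y h)) x)
        - mlieBracket (𝓡 6) X Y x =
    -(mlieBracket (𝓡 6) (fun h => J h (Y h)) (fun h => J h (X h)) x
        - J x (mlieBracket (𝓡 6) (fun h => J h (Y h)) X x)
        - J x (mlieBracket (𝓡 6) Y (fun h => J h (X h)) x)
        - mlieBracket (𝓡 6) Y X x) := by
  rw [mlieBracket_swap_apply (V := fun h => J h (X h)) (W := fun h => J h (Y h)),
    mlieBracket_swap_apply (V := fun h => J h (X h)) (W := Y),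
    mlieBracket_swap_apply (V := X) (W := fun h => J h (Y h)),
    mlieBracket_swap_apply (V := X) (W := Y)]
  simp only [map_neg]
  abel

/-- The value of the Nijenhuis tensor of a left-invariant almost complex structure on left-invariant
vector fields is the left-invariant field of the algebraic Nijenhuis tensor. -/
theorem nijenhuis_mulInvariantVectorField
    (J : GroupLieAlgebra (𝓡 6) G →ₗ[ℝ] GroupLieAlgebra (𝓡 6) G)
    (v w : GroupLieAlgebra (𝓡 6) G) (x : G) :
    let V := mulInvariantVectorField (I := 𝓡 6) (G := G) v
    let W := mulInvariantVectorField (I := 𝓡 6) (G := G) w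
    let K := leftInvariantEnd (𝓡 6) J
    mlieBracket (𝓡 6) (fun h => K h (V h)) (fun h => K h (W h)) x
        - K x (mlieBracket (𝓡 6) (fun h => K h (V h)) W x)
        - K x (mlieBracket (𝓡 6) V (fun h => K h (W h)) x)
        - mlieBracket (𝓡 6) V W x =
      mulInvariantVectorField (I := 𝓡 6) (G := G)
        (⁅J v, J w⁆ - J ⁅J v, w⁆ - J ⁅v, J w⁆ - ⁅v, w⁆) x := by
  intro V W K
  have hV : (fun h => K h (V h)) = mulInvariantVectorField (J v) :=
    funext fun h => leftInvariantEnd_mulInvariantVectorField J v h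
  have hW : (fun h => K h (W h)) = mulInvariantVectorField (J w) :=
    funext fun h => leftInvariantEnd_mulInvariantVectorField J w h
  have hb : ∀ a b : GroupLieAlgebra (𝓡 6) G,
      mlieBracket (𝓡 6) (mulInvariantVectorField a) (mulInvariantVectorField b) x =
        mulInvariantVectorField ⁅a, b⁆ x := fun a b =>
    (congrFun (mulInvariantVector_mlieBracket a b) x).symm
  rw [hV, hW, hb, hb, hb, hb, leftInvariantEnd_mulInvariantVectorField,
    leftInvariantEnd_mulInvariantVectorField]
  have hs : ∀ a b : GroupLieAlgebra (𝓡 6) G, mulInvariantVectorField (a - b) x =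
      mulInvariantVectorField a x - mulInvariantVectorField b x := fun a b =>
    map_sub (leftDeriv (𝓡 6) x 1) a b
  rw [hs, hs, hs]

/-- A complex structure on the Lie algebra of `G` extends to a left-invariant complex structure. -/
theorem isLeftInvariantComplexStructure_leftInvariantEnd
    {J : GroupLieAlgebra (𝓡 6) G →ₗ[ℝ] GroupLieAlgebra (𝓡 6) G}
    (hJ : IsComplexStructure (GroupLieAlgebra (𝓡 6) G) J) :
    IsLeftInvariantComplexStructure G (leftInvariantEnd (𝓡 6) J) := by
  have hsq : ∀ (g : G) (v : TangentSpace (𝓡 6) g),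
      leftInvariantEnd (𝓡 6) J g (leftInvariantEnd (𝓡 6) J g v) = -v := by
    intro g v
    obtain ⟨w, rfl⟩ : ∃ w : GroupLieAlgebra (𝓡 6) G, mulInvariantVectorField w g = v :=
      ⟨_, mulInvariantVectorField_maurerCartan g v⟩
    rw [leftInvariantEnd_mulInvariantVectorField, leftInvariantEnd_mulInvariantVectorField,
      hJ.sq_eq_neg]
    exact map_neg (leftDeriv (𝓡 6) g 1) w
  have hd : ∀ (x : G) (X : ∀ g : G, TangentSpace (𝓡 6) g),
      MDifferentiableAt (𝓡 6) (𝓡 6).tangent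
        (fun g => (⟨g, X g⟩ : TangentBundle (𝓡 6) G)) x →
      MDifferentiableAt (𝓡 6) (𝓡 6).tangent
        (fun g => (⟨g, leftInvariantEnd (𝓡 6) J g (X g)⟩ : TangentBundle (𝓡 6) G)) x :=
    fun x X hX => (((contMDiff_leftInvariantEnd J).mdifferentiable (by simp)) _).comp x hX
  refine ⟨fun X hX => (contMDiff_leftInvariantEnd J).comp hX, hsq, fun X Y hX hY x => ?_,
    leftInvariantEnd_leftInvariant J⟩
  -- By tensoriality, `X` and `Y` may be replaced by left-invariant fields.
  have h₁ := fun Y : (∀ g : G, TangentSpace (𝓡 6) g) => tensorialAt_nijenhuis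
    (leftInvariantEnd (𝓡 6) J) hsq x (hd x) Y
  have key := TensorialAt.pointwise₂ (I := 𝓡 6) (F := EuclideanSpace ℝ (Fin 6))
    (F' := EuclideanSpace ℝ (Fin 6)) (x := x)
    (Φ := fun X Y : (∀ g : G, TangentSpace (𝓡 6) g) =>
      mlieBracket (𝓡 6) (fun h => leftInvariantEnd (𝓡 6) J h (X h))
          (fun h => leftInvariantEnd (𝓡 6) J h (Y h)) x
        - leftInvariantEnd (𝓡 6) J x
          (mlieBracket (𝓡 6) (fun h => leftInvariantEnd (𝓡 6) J h (X h)) Y x)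
        - leftInvariantEnd (𝓡 6) J x
          (mlieBracket (𝓡 6) X (fun h => leftInvariantEnd (𝓡 6) J h (Y h)) x)
        - mlieBracket (𝓡 6) X Y x)
    (fun Y _ => h₁ Y)
    (fun X _ => by
      constructor
      · intro f Y hf hY
        simp only [nijenhuis_swap _ X]
        rw [(h₁ X).smul hf hY, smul_neg]
      · intro Y Y' hY hY'
        simp only [nijenhuis_swap _ X]
        rw [(h₁ X).add hY hY', neg_add])
    (hX.mdifferentiable (by simp) x)
    (mdifferentiableAt_mulInvariantVectorField
      (maurerCartan (I := 𝓡 6) x (X x) : GroupLieAlgebra (𝓡 6) G))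
    (hY.mdifferentiable (by simp) x)
    (mdifferentiableAt_mulInvariantVectorField
      (maurerCartan (I := 𝓡 6) x (Y x) : GroupLieAlgebra (𝓡 6) G))
    (mulInvariantVectorField_maurerCartan x (X x)).symm
    (mulInvariantVectorField_maurerCartan x (Y x)).symm
  refine key.trans ((nijenhuis_mulInvariantVectorField J _ _ x).trans ?_)
  exact (congrArg (fun u : GroupLieAlgebra (𝓡 6) G => mulInvariantVectorField u x)
    (hJ.nijenhuis_eq_zero _ _)).trans (map_zero (leftDeriv (𝓡 6) x 1))

theorem contMDiff_mulInvariantVectorField_infty (v : GroupLieAlgebra (𝓡 6) G) :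
    ContMDiff (𝓡 6) (𝓡 6).tangent ∞
      (fun g : G => (⟨g, mulInvariantVectorField v g⟩ : TangentBundle (𝓡 6) G)) := by
  refine (contMDiff_leftTranslate contMDiff_id
    (contMDiff_const (c := (⟨1, v⟩ : TangentBundle (𝓡 6) G)))).congr fun g => ?_
  exact congrArg (fun h : G => (⟨h, leftDeriv (𝓡 6) g 1 v⟩ : TangentBundle (𝓡 6) G))
    (mul_one g).symm

/-- A left-invariant complex structure restricts to a complex structure on the Lie algebra. -/
theorem IsLeftInvariantComplexStructure.isComplexStructure_one
    {J : ∀ g : G, TangentSpace (𝓡 6) g →ₗ[ℝ] TangentSpace (𝓡 6) g}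
    (hJ : IsLeftInvariantComplexStructure G J) :
    IsComplexStructure (GroupLieAlgebra (𝓡 6) G) (J 1) := by
  refine ⟨hJ.sq_eq_neg 1, fun v w => ?_⟩
  -- The field `J` with the base points forgotten in its type.
  let J' : G → EuclideanSpace ℝ (Fin 6) →ₗ[ℝ] EuclideanSpace ℝ (Fin 6) := J
  have hinv : ∀ v : GroupLieAlgebra (𝓡 6) G,
      (fun g => J g (mulInvariantVectorField v g)) = mulInvariantVectorField (J 1 v) := by
    intro v
    funext g
    have h := hJ.left_invariant g 1 v
    have e : (J' (g * 1) : EuclideanSpace ℝ (Fin 6) →ₗ[ℝ] EuclideanSpace ℝ (Fin 6)) = J' g :=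
      congrArg J' (mul_one g)
    exact (LinearMap.congr_fun e (leftDeriv (𝓡 6) g 1 v)).symm.trans h
  have h := hJ.nijenhuis_eq_zero _ _ (contMDiff_mulInvariantVectorField_infty v)
    (contMDiff_mulInvariantVectorField_infty w) 1
  rw [hinv, hinv] at h
  exact h

theorem exists_isLeftInvariantComplexStructure_iff :
    (∃ J : ∀ g : G, TangentSpace (𝓡 6) g →ₗ[ℝ] TangentSpace (𝓡 6) g,
      IsLeftInvariantComplexStructure G J) ↔
    ∃ J : GroupLieAlgebra (𝓡 6) G →ₗ[ℝ] GroupLieAlgebra (𝓡 6) G,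
      IsComplexStructure (GroupLieAlgebra (𝓡 6) G) J :=
  ⟨fun ⟨J, hJ⟩ => ⟨J 1, hJ.isComplexStructure_one⟩,
    fun ⟨J, hJ⟩ => ⟨leftInvariantEnd (𝓡 6) J, isLeftInvariantComplexStructure_leftInvariantEnd hJ⟩⟩

end SixDimensional

/-! ### The explicit complex structures on the 26 families -/

section ExplicitStructures

variable {B : Matrix (Fin 5) (Fin 5) ℝ}

theorem Alg.sub_apply (x y : Alg B) (i : Fin 6) : (x - y) i = x i - y i := rfl

theorem Alg.neg_apply (x : Alg B) (i : Fin 6) : (-x) i = -x i := rfl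

theorem pairMap_apply (a b : Fin 6) (x : Alg B) (i : Fin 6) :
    pairMap a b x i = x a * (if i = b then 1 else 0) - x b * (if i = a then 1 else 0) := by
  change x a * (Pi.single b (1 : ℝ) : Fin 6 → ℝ) i - x b * (Pi.single a (1 : ℝ) : Fin 6 → ℝ) i = _
  rw [Pi.single_apply, Pi.single_apply]

theorem basisVec_apply (a i : Fin 6) : (basisVec a : Alg B) i = if i = a then 1 else 0 :=
  Pi.single_apply a (1 : ℝ) i

theorem stdJ_apply (a₁ b₁ a₂ b₂ a₃ b₃ : ℕ) (x : Alg B) (i : Fin 6) :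
    stdJ a₁ b₁ a₂ b₂ a₃ b₃ x i =
      pairMap (Fin.ofNat 6 (a₁ - 1)) (Fin.ofNat 6 (b₁ - 1)) x i
        + pairMap (Fin.ofNat 6 (a₂ - 1)) (Fin.ofNat 6 (b₂ - 1)) x i
        + pairMap (Fin.ofNat 6 (a₃ - 1)) (Fin.ofNat 6 (b₃ - 1)) x i := rfl

/-! The endomorphisms `stdJ` that occur in the list, in coordinates. -/

theorem stdJ_162345 (x : Alg B) (i : Fin 6) :
    stdJ 1 6 2 3 4 5 x i = ![-x 5, -x 2, x 1, -x 4, x 3, x 0] i := by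
  fin_cases i <;> simp [stdJ_apply, pairMap_apply, Fin.ofNat]

theorem stdJ_123645 (x : Alg B) (i : Fin 6) :
    stdJ 1 2 3 6 4 5 x i = ![-x 1, x 0, -x 5, -x 4, x 3, x 2] i := by
  fin_cases i <;> simp [stdJ_apply, pairMap_apply, Fin.ofNat]

theorem stdJ_123456 (x : Alg B) (i : Fin 6) :
    stdJ 1 2 3 4 5 6 x i = ![-x 1, x 0, -x 3, x 2, -x 5, x 4] i := by
  fin_cases i <;> simp [stdJ_apply, pairMap_apply, Fin.ofNat]

theorem stdJ_213645 (x : Alg B) (i : Fin 6) :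
    stdJ 2 1 3 6 4 5 x i = ![x 1, -x 0, -x 5, -x 4, x 3, x 2] i := by
  fin_cases i <;> simp [stdJ_apply, pairMap_apply, Fin.ofNat]

theorem stdJ_142536 (x : Alg B) (i : Fin 6) :
    stdJ 1 4 2 5 3 6 x i = ![-x 3, -x 4, -x 5, x 0, x 1, x 2] i := by
  fin_cases i <;> simp [stdJ_apply, pairMap_apply, Fin.ofNat]

theorem stdJ_162435 (x : Alg B) (i : Fin 6) :
    stdJ 1 6 2 4 3 5 x i = ![-x 5, -x 3, -x 4, x 1, x 2, x 0] i := by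
  fin_cases i <;> simp [stdJ_apply, pairMap_apply, Fin.ofNat]

theorem stdJ_123546 (x : Alg B) (i : Fin 6) :
    stdJ 1 2 3 5 4 6 x i = ![-x 1, x 0, -x 4, -x 5, x 2, x 3] i := by
  fin_cases i <;> simp [stdJ_apply, pairMap_apply, Fin.ofNat]

theorem stdJ_132456 (x : Alg B) (i : Fin 6) :
    stdJ 1 3 2 4 5 6 x i = ![-x 2, -x 3, x 0, x 1, -x 5, x 4] i := by
  fin_cases i <;> simp [stdJ_apply, pairMap_apply, Fin.ofNat]

/-- The adjoint action of `f_6` in coordinates: the matrix `B` on the first five coordinates. -/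
def Alg.adSix (y : Alg B) : Alg B :=
  Fin.snoc (α := fun _ => ℝ) (fun k : Fin 5 => ∑ j : Fin 5, B k j * y j.castSucc) 0

theorem Alg.adSix_apply (y : Alg B) (i : Fin 6) : Alg.adSix y i =
    ![B 0 0 * y 0 + B 0 1 * y 1 + B 0 2 * y 2 + B 0 3 * y 3 + B 0 4 * y 4,
      B 1 0 * y 0 + B 1 1 * y 1 + B 1 2 * y 2 + B 1 3 * y 3 + B 1 4 * y 4,
      B 2 0 * y 0 + B 2 1 * y 1 + B 2 2 * y 2 + B 2 3 * y 3 + B 2 4 * y 4,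
      B 3 0 * y 0 + B 3 1 * y 1 + B 3 2 * y 2 + B 3 3 * y 3 + B 3 4 * y 4,
      B 4 0 * y 0 + B 4 1 * y 1 + B 4 2 * y 2 + B 4 3 * y 3 + B 4 4 * y 4, 0] i := by
  have h : ∀ k : Fin 5, Alg.adSix y k.castSucc = ∑ j : Fin 5, B k j * y j.castSucc := fun k => by
    simp only [Alg.adSix, Fin.snoc_castSucc]
  have h5 : Alg.adSix y 5 = 0 := Fin.snoc_last (α := fun _ => ℝ) _ _
  fin_cases i
  · exact (h 0).trans (Fin.sum_univ_five _)
  · exact (h 1).trans (Fin.sum_univ_five _)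
  · exact (h 2).trans (Fin.sum_univ_five _)
  · exact (h 3).trans (Fin.sum_univ_five _)
  · exact (h 4).trans (Fin.sum_univ_five _)
  · exact h5

theorem Alg.lie_eq (x y : Alg B) : ⁅x, y⁆ = x 5 • Alg.adSix y - y 5 • Alg.adSix x := by
  refine Alg.ext_castSucc (fun k => ?_) ?_
  · rw [Alg.bracket_castSucc, Alg.sub_apply, Alg.smul_apply, Alg.smul_apply, Alg.adSix, Alg.adSix,
      Fin.snoc_castSucc, Fin.snoc_castSucc, Finset.mul_sum, Finset.mul_sum,
      ← Finset.sum_sub_distrib, ← Finset.sum_neg_distrib]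
    exact Finset.sum_congr rfl fun j _ => by ring
  · rw [Alg.bracket_five, Alg.sub_apply, Alg.smul_apply, Alg.smul_apply]
    simp [Alg.adSix_apply]

/-- An almost complex structure `J` on `Alg B` is integrable as soon as the commutator of `ad f_6`
and `J` vanishes on the largest `J`-invariant subspace of the ideal spanned by `f_1, …, f_5`, and
maps the remaining complex line complex antilinearly, which is what `h` says. -/
theorem Alg.isComplexStructure_of_commutator {J : Alg B →ₗ[ℝ] Alg B}
    (hsq : ∀ x, J (J x) = -x) (a : Alg B)
    (h : ∀ y i, Alg.adSix (J y) i - J (Alg.adSix y) i = y 5 * a i + J y 5 * J a i) :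
    IsComplexStructure (Alg B) J := by
  refine ⟨hsq, fun x y => ?_⟩
  have h' : ∀ y, Alg.adSix (J y) = J (Alg.adSix y) + (y 5 • a + J y 5 • J a) := fun y =>
    funext fun i => sub_eq_iff_eq_add'.1 (h y i)
  simp only [Alg.lie_eq, h', map_sub, map_add, map_smul, hsq]
  module

theorem Family.complexStructure_sq (k : Family) (x : k.algebra) :
    k.complexStructure (k.complexStructure x) = -x := by
  refine funext fun i => ?_
  cases k <;> fin_cases i <;>
    simp [Family.complexStructure, Alg.neg_apply, stdJ_162345, stdJ_123645, stdJ_123456,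
      stdJ_213645, stdJ_142536, stdJ_162435, stdJ_123546, stdJ_132456]

set_option maxHeartbeats 2000000 in
theorem Family.isComplexStructure (k : Family) :
    IsComplexStructure k.algebra k.complexStructure := by
  refine Alg.isComplexStructure_of_commutator k.complexStructure_sq
    (Alg.adSix (k.complexStructure (basisVec 5))) fun y i => ?_
  cases k <;> fin_cases i <;>
    simp only [Family.complexStructure, stdJ_162345, stdJ_123645, stdJ_123456, stdJ_213645,
      stdJ_142536, stdJ_162435, stdJ_123546, stdJ_132456, Alg.adSix_apply, basisVec_apply] <;>
    simp [Family.coeff, Fin.ext_iff] <;> ring_nf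

end ExplicitStructures

/-! ### Normal forms over the complex numbers -/

section NormalForm

open Module

/-- A linear endomorphism of a complex plane is, in a suitable basis, diagonal or a Jordan block. -/
theorem exists_diagonal_or_jordan {V : Type*} [AddCommGroup V] [Module ℂ V]
    (hV : finrank ℂ V = 2) (T : V →ₗ[ℂ] V) :
    ∃ (u w : V) (l m : ℂ), LinearIndependent ℂ ![u, w] ∧ T u = l • u ∧
      (T w = m • w ∨ T w = l • w + u) := by
  have : FiniteDimensional ℂ V := FiniteDimensional.of_finrank_pos (by omega)
  have : Nontrivial V := Module.nontrivial_of_finrank_pos (R := ℂ) (by omega)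
  obtain ⟨l, hl⟩ := Module.End.exists_eigenvalue T
  obtain ⟨u, hu⟩ := hl.exists_hasEigenvector
  have hTu : T u = l • u := hu.apply_eq_smul
  obtain ⟨w, hw⟩ : ∃ w, w ∉ Submodule.span ℂ {u} := by
    by_contra! h
    have : finrank ℂ V ≤ 1 := finrank_le_one u fun w => Submodule.mem_span_singleton.1 (h w)
    omega
  have hind : LinearIndependent ℂ ![u, w] :=
    (LinearIndependent.pair_iff' hu.2).2 fun a ha =>
      hw (Submodule.mem_span_singleton.2 ⟨a, ha⟩)
  have hspan : ∀ v : V, ∃ a b : ℂ, v = a • u + b • w := by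
    intro v
    have htop := hind.span_eq_top_of_card_eq_finrank (by simp [hV])
    have hv : v ∈ Submodule.span ℂ (Set.range ![u, w]) := htop ▸ Submodule.mem_top
    rw [Matrix.range_cons, Matrix.range_cons, Matrix.range_empty, Set.union_empty,
      Set.singleton_union, Submodule.mem_span_pair] at hv
    obtain ⟨a, b, h⟩ := hv
    exact ⟨a, b, h.symm⟩
  obtain ⟨n, m, hTw⟩ := hspan (T w)
  by_cases hlm : l = m
  · subst hlm
    by_cases hn : n = 0
    · exact ⟨u, w, l, l, hind, hTu, Or.inl (by rw [hTw, hn, zero_smul, zero_add])⟩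
    · refine ⟨n • u, w, l, l, ?_, by rw [map_smul, hTu, smul_comm], Or.inr (by rw [hTw, add_comm])⟩
      rw [LinearIndependent.pair_iff] at hind ⊢
      intro s t hst
      rw [smul_smul] at hst
      obtain ⟨h1, h2⟩ := hind _ _ hst
      exact ⟨(mul_eq_zero.1 h1).resolve_right hn, h2⟩
  · -- The eigenvector for `m` is `w + (n / (m - l)) u`.
    have hd : m - l ≠ 0 := sub_ne_zero.2 (Ne.symm hlm)
    refine ⟨u, w + (n / (m - l)) • u, l, m, ?_, hTu, Or.inl ?_⟩
    · rw [LinearIndependent.pair_iff] at hind ⊢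
      intro s t hst
      have : (s + t * (n / (m - l))) • u + t • w = 0 := by rw [← hst]; module
      obtain ⟨h1, h2⟩ := hind _ _ this
      rw [h2, zero_mul, add_zero] at h1
      exact ⟨h1, h2⟩
    · rw [map_add, map_smul, hTu, hTw]
      match_scalars
      · field_simp
        ring
      · ring

/-- Let `T` be an endomorphism of a complex plane, extended to one more vector `e` by
`e ↦ a e + v`. Replacing `e` by `e + x` replaces `v` by `v + T x - a x`; a suitable `x` and a
suitable Jordan basis `u, w` of `T` give one of four normal forms. -/
theorem exists_extension_normalForm {V : Type*} [AddCommGroup V] [Module ℂ V]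
    (hV : finrank ℂ V = 2) (T : V →ₗ[ℂ] V) (a : ℂ) (v : V) :
    ∃ (x u w : V) (l m : ℂ), LinearIndependent ℂ ![u, w] ∧
      ((T u = l • u ∧ T w = m • w ∧ v + T x - a • x = 0) ∨
       (T u = a • u ∧ T w = m • w ∧ v + T x - a • x = u) ∨
       (T u = l • u ∧ T w = l • w + u ∧ v + T x - a • x = 0) ∨
       (T u = a • u ∧ T w = a • w + u ∧ v + T x - a • x = w)) := by
  obtain ⟨u, w, l, m, hind, hu, hw⟩ := exists_diagonal_or_jordan hV T
  have hspan : ∃ α β : ℂ, v = α • u + β • w := by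
    have : FiniteDimensional ℂ V := FiniteDimensional.of_finrank_pos (by omega)
    have htop := hind.span_eq_top_of_card_eq_finrank (by simp [hV])
    have hv : v ∈ Submodule.span ℂ (Set.range ![u, w]) := htop ▸ Submodule.mem_top
    rw [Matrix.range_cons, Matrix.range_cons, Matrix.range_empty, Set.union_empty,
      Set.singleton_union, Submodule.mem_span_pair] at hv
    obtain ⟨a, b, h⟩ := hv
    exact ⟨a, b, h.symm⟩
  obtain ⟨α, β, rfl⟩ := hspan
  have hsmul : ∀ s t c : ℂ, s ≠ 0 → t ≠ 0 → LinearIndependent ℂ ![s • u + c • w, t • w] := by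
    intro s t c hs ht
    rw [LinearIndependent.pair_iff] at hind ⊢
    intro p q hpq
    have : (p * s) • u + (p * c + q * t) • w = 0 := by rw [← hpq]; module
    obtain ⟨h1, h2⟩ := hind _ _ this
    have hp := (mul_eq_zero.1 h1).resolve_right hs
    rw [hp, zero_mul, zero_add] at h2
    exact ⟨hp, (mul_eq_zero.1 h2).resolve_right ht⟩
  have hswap : LinearIndependent ℂ ![w, u] := by
    rw [LinearIndependent.pair_iff] at hind ⊢
    intro s t h
    exact (hind t s (by rw [add_comm, h])).symm
  rcases hw with hw | hw
  · -- Shift away the components of `v` along the eigenvectors with eigenvalue different from `a`.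
    obtain ⟨s, α', hα, hα'⟩ : ∃ s α' : ℂ, α + (l - a) * s = α' ∧ (α' = 0 ∨ l = a) := by
      by_cases h : l = a
      · exact ⟨0, α, by ring, Or.inr h⟩
      · have : l - a ≠ 0 := sub_ne_zero.2 h
        exact ⟨-α / (l - a), 0, by field_simp; ring, Or.inl rfl⟩
    obtain ⟨t, β', hβ, hβ'⟩ : ∃ t β' : ℂ, β + (m - a) * t = β' ∧ (β' = 0 ∨ m = a) := by
      by_cases h : m = a
      · exact ⟨0, β, by ring, Or.inr h⟩
      · have : m - a ≠ 0 := sub_ne_zero.2 h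
        exact ⟨-β / (m - a), 0, by field_simp; ring, Or.inl rfl⟩
    have hx : α • u + β • w + T (s • u + t • w) - a • (s • u + t • w) = α' • u + β' • w := by
      rw [map_add, map_smul, map_smul, hu, hw, ← hα, ← hβ]
      module
    by_cases h0 : α' = 0
    · rw [h0, zero_smul, zero_add] at hx
      by_cases h1 : β' = 0
      · rw [h1, zero_smul] at hx
        exact ⟨_, u, w, l, m, hind, Or.inl ⟨hu, hw, hx⟩⟩
      · have hm := hβ'.resolve_left h1
        subst hm
        refine ⟨_, β' • w, u, l, l, ?_, Or.inr (Or.inl ⟨?_, hu, hx⟩)⟩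
        · rw [LinearIndependent.pair_iff] at hswap ⊢
          intro p q hpq
          rw [smul_smul] at hpq
          obtain ⟨h2, h3⟩ := hswap _ _ hpq
          exact ⟨(mul_eq_zero.1 h2).resolve_right h1, h3⟩
        · rw [map_smul, hw, smul_comm]
    · have hl := hα'.resolve_left h0
      subst hl
      have hu' : T (α' • u + β' • w) = l • (α' • u + β' • w) := by
        rw [map_add, map_smul, map_smul, hu, hw]
        rcases hβ' with h1 | h1
        · rw [h1]; module
        · rw [h1]; module
      refine ⟨_, α' • u + β' • w, w, l, m, ?_, Or.inr (Or.inl ⟨hu', hw, hx⟩)⟩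
      simpa using hsmul α' 1 β' h0 one_ne_zero
  · have hx : ∀ s t : ℂ, α • u + β • w + T (s • u + t • w) - a • (s • u + t • w) =
        (α + (l - a) * s + t) • u + (β + (l - a) * t) • w := by
      intro s t
      rw [map_add, map_smul, map_smul, hu, hw]
      module
    by_cases h : l = a
    · subst h
      have hx' : α • u + β • w + T ((-α) • w) - l • ((-α) • w) = β • w := by
        rw [map_smul, hw]
        module
      by_cases hβ : β = 0
      · exact ⟨_, u, w, l, l, hind, Or.inr (Or.inr (Or.inl ⟨hu, hw, by rw [hx', hβ, zero_smul]⟩))⟩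
      · refine ⟨_, β • u, β • w, l, l, ?_, Or.inr (Or.inr (Or.inr ⟨?_, ?_, hx'⟩))⟩
        · simpa using hsmul β β 0 hβ hβ
        · rw [map_smul, hu, smul_comm]
        · rw [map_smul, hw, smul_add, smul_comm]
    · have hd : l - a ≠ 0 := sub_ne_zero.2 h
      refine ⟨(-(α + -β / (l - a)) / (l - a)) • u + (-β / (l - a)) • w, u, w, l, l, hind,
        Or.inr (Or.inr (Or.inl ⟨hu, hw, ?_⟩))⟩
      rw [hx]
      match_scalars
      · field_simp
        ring
      · field_simp
        ring

end NormalForm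

/-! ### Recognizing `Alg M` from a basis -/

section Structure

open Module

theorem Alg.adSix_single (M : Matrix (Fin 5) (Fin 5) ℝ) (j : Fin 5) (k : Fin 5) :
    Alg.adSix (basisVec j.castSucc : Alg M) k.castSucc = M k j := by
  simp only [Alg.adSix, Fin.snoc_castSucc, basisVec_apply, Fin.castSucc_inj]
  simp

/-- A six-dimensional Lie algebra is isomorphic to `Alg M` if it has a basis satisfying the
structure equations of `Alg M`. -/
theorem nonempty_lieEquiv_alg {L : Type*} [LieRing L] [LieAlgebra ℝ L] (b : Basis (Fin 6) ℝ L)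
    (M : Matrix (Fin 5) (Fin 5) ℝ) (h0 : ∀ i j : Fin 5, ⁅b i.castSucc, b j.castSucc⁆ = 0)
    (h5 : ∀ j : Fin 5, ⁅b 5, b j.castSucc⁆ = ∑ k : Fin 5, M k j • b k.castSucc) :
    Nonempty (L ≃ₗ⁅ℝ⁆ Alg M) := by
  let e : L ≃ₗ[ℝ] Alg M := b.equivFun
  have he : ∀ i, e (b i) = basisVec i := fun i => by
    change b.equivFun (b i) = Pi.single i 1
    funext j
    rw [Basis.equivFun_apply, Basis.repr_self, Finsupp.single_eq_pi_single]
  have h5' : ∀ j : Fin 5, e ⁅b 5, b j.castSucc⁆ = ⁅e (b 5), e (b j.castSucc)⁆ := by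
    intro j
    rw [h5, map_sum, he, he, Alg.lie_eq]
    refine Alg.ext_castSucc (fun k => ?_) ?_
    · have : ∀ x : Fin 5 → Alg M, ∀ i, (∑ k, x k) i = ∑ k, x k i := fun x i =>
        Finset.sum_apply i Finset.univ x
      rw [this, Alg.sub_apply, Alg.smul_apply, Alg.smul_apply, Alg.adSix_single, basisVec_apply,
        basisVec_apply]
      have h6 : (5 : Fin 6) ≠ j.castSucc := (Fin.castSucc_lt_last j).ne'
      simp only [map_smul, he, Alg.smul_apply, basisVec_apply, Fin.castSucc_inj]
      simp [h6]
    · have : ∀ x : Fin 5 → Alg M, ∀ i, (∑ k, x k) i = ∑ k, x k i := fun x i =>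
        Finset.sum_apply i Finset.univ x
      rw [this, Alg.sub_apply, Alg.smul_apply, Alg.smul_apply]
      have h6 : ∀ k : Fin 5, (5 : Fin 6) ≠ k.castSucc := fun k => (Fin.castSucc_lt_last k).ne'
      simp [he, Alg.smul_apply, basisVec_apply, Alg.adSix_apply, h6]
  have key : ∀ i j : Fin 6, e ⁅b i, b j⁆ = ⁅e (b i), e (b j)⁆ := by
    intro i j
    induction i using Fin.lastCases with
    | last =>
      induction j using Fin.lastCases with
      | last => rw [lie_self, lie_self, map_zero]
      | cast j => exact h5' j
    | cast i =>
      induction j using Fin.lastCases with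
      | last =>
        rw [← lie_skew, map_neg, ← lie_skew (e (b i.castSucc))]
        exact congrArg _ (h5' i)
      | cast j =>
        have h6 : ∀ k : Fin 5, (5 : Fin 6) ≠ k.castSucc := fun k => (Fin.castSucc_lt_last k).ne'
        rw [h0, map_zero, he, he, Alg.lie_eq, basisVec_apply, basisVec_apply, if_neg (h6 i),
          if_neg (h6 j), zero_smul, zero_smul, sub_zero]
  have hlie : ∀ x y : L, e ⁅x, y⁆ = ⁅e x, e y⁆ := by
    intro x y
    have := LinearMap.ext_basis
      (B := (LieModule.toEnd ℝ L L : L →ₗ[ℝ] L →ₗ[ℝ] L).compr₂ (e : L →ₗ[ℝ] Alg M))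
      (B' := (LieModule.toEnd ℝ (Alg M) (Alg M) : Alg M →ₗ[ℝ] Alg M →ₗ[ℝ] Alg M).compl₁₂
        (e : L →ₗ[ℝ] Alg M) (e : L →ₗ[ℝ] Alg M)) b b (fun i j => key i j)
    exact LinearMap.congr_fun₂ this x y
  exact ⟨{ e with map_lie' := fun {x y} => hlie x y }⟩

/-- The matrix of `e ↦ a e + p u + q w`, `u ↦ (x + i y) u`, `w ↦ (x' + i y') w + n u` in the real
basis `e, u, i u, w, i w`. -/
def modelMatrix (a x y x' y' p q n : ℝ) : Matrix (Fin 5) (Fin 5) ℝ :=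
  !![a, 0, 0, 0, 0;
    p, x, -y, n, 0;
    0, y, x, 0, n;
    q, 0, 0, x', -y';
    0, 0, 0, y', x']

variable {L : Type*} [LieRing L] [LieAlgebra ℝ L] [Module ℂ L] [IsScalarTower ℝ ℂ L]

theorem complex_smul_eq (z : ℂ) (v : L) : z • v = z.re • v + z.im • (Complex.I • v) := by
  rw [← smul_assoc, ← algebraMap_smul ℂ z.re v, ← add_smul]
  congr 1
  apply Complex.ext <;> simp

theorem nonempty_lieEquiv_modelMatrix {I : LieIdeal ℝ L} (hI : IsLieAbelian I)
    (hL : finrank ℝ L = 6) {e u w : L} (hind : LinearIndependent ℂ ![e, u, w])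
    (he : e ∈ I) (hu : u ∈ I) (hiu : Complex.I • u ∈ I) (hw : w ∈ I) (hiw : Complex.I • w ∈ I)
    {a x y x' y' p q n : ℝ}
    (h₀ : ⁅Complex.I • e, e⁆ = a • e + p • u + q • w)
    (h₁ : ⁅Complex.I • e, u⁆ = x • u + y • (Complex.I • u))
    (h₂ : ⁅Complex.I • e, Complex.I • u⁆ = -y • u + x • (Complex.I • u))
    (h₃ : ⁅Complex.I • e, w⁆ = n • u + x' • w + y' • (Complex.I • w))
    (h₄ : ⁅Complex.I • e, Complex.I • w⁆ = n • (Complex.I • u) - y' • w + x' • (Complex.I • w)) :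
    Nonempty (L ≃ₗ⁅ℝ⁆ Alg (modelMatrix a x y x' y' p q n)) := by
  let v : Fin 6 → L := ![e, u, Complex.I • u, w, Complex.I • w, Complex.I • e]
  have hv : LinearIndependent ℝ v := by
    rw [Fintype.linearIndependent_iff] at hind ⊢
    intro g hg
    have hz : ((g 0 : ℂ) + g 5 * Complex.I) • e + ((g 1 : ℂ) + g 2 * Complex.I) • u +
        ((g 3 : ℂ) + g 4 * Complex.I) • w = 0 := by
      rw [← hg, Fin.sum_univ_six, complex_smul_eq, complex_smul_eq _ u, complex_smul_eq _ w]
      simp [v]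
      abel
    have h := hind ![(g 0 : ℂ) + g 5 * Complex.I, (g 1 : ℂ) + g 2 * Complex.I,
      (g 3 : ℂ) + g 4 * Complex.I] (by simpa [Fin.sum_univ_three] using hz)
    have h0 := h 0
    have h1 := h 1
    have h2 := h 2
    simp [Complex.ext_iff] at h0 h1 h2
    intro i
    fin_cases i
    exacts [h0.1, h1.1, h1.2, h2.1, h2.2, h0.2]
  let b : Basis (Fin 6) ℝ L := basisOfLinearIndependentOfCardEqFinrank hv (by simp [hL])
  have hb : ∀ i, b i = v i := fun i => by simp [b]
  have hvI : ∀ i : Fin 5, v i.castSucc ∈ I := by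
    intro i
    fin_cases i
    exacts [he, hu, hiu, hw, hiw]
  refine nonempty_lieEquiv_alg b _ (fun i j => ?_) (fun j => ?_)
  · rw [hb, hb]
    have := hI.trivial ⟨_, hvI i⟩ ⟨_, hvI j⟩
    exact congrArg Subtype.val this
  · simp only [hb, Fin.sum_univ_five]
    fin_cases j
    · refine h₀.trans ?_
      simp [v, modelMatrix]
    · refine h₁.trans ?_
      simp [v, modelMatrix]
    · refine h₂.trans ?_
      simp [v, modelMatrix]
    · refine h₃.trans ?_
      simp [v, modelMatrix]
    · refine h₄.trans ?_
      simp [v, modelMatrix]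
      abel

end Structure

/-! ### A basis adapted to the complex structure -/

section AdaptedBasis

open Module

section ComplexScalars

variable {L : Type*} [LieRing L] [LieAlgebra ℝ L] [Module ℂ L] [IsScalarTower ℝ ℂ L]

omit [LieAlgebra ℝ L] [IsScalarTower ℝ ℂ L] in
theorem I_smul_I_smul (x : L) : Complex.I • Complex.I • x = -x := by
  rw [smul_smul, Complex.I_mul_I, neg_one_smul]

theorem I_smul_real_smul (r : ℝ) (x : L) : Complex.I • r • x = r • Complex.I • x := by
  rw [← algebraMap_smul ℂ r x, ← algebraMap_smul ℂ r (Complex.I • x), smul_comm]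

/-- The largest complex subspace of a Lie ideal. -/
def maximalComplexSubspace (I : LieIdeal ℝ L) : Submodule ℂ L where
  carrier := {x | x ∈ I ∧ Complex.I • x ∈ I}
  add_mem' hx hy := ⟨add_mem hx.1 hy.1, by rw [smul_add]; exact add_mem hx.2 hy.2⟩
  zero_mem' := ⟨zero_mem _, by rw [smul_zero]; exact zero_mem _⟩
  smul_mem' z x hx := by
    have hr : ∀ (r : ℝ) {y : L}, y ∈ I → r • y ∈ I := fun r y hy =>
      I.toSubmodule.smul_mem r hy
    constructor
    · rw [complex_smul_eq]
      exact add_mem (hr _ hx.1) (hr _ hx.2)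
    · rw [smul_comm, complex_smul_eq, I_smul_I_smul]
      exact add_mem (hr _ hx.2) (hr _ (neg_mem hx.1))

theorem mem_maximalComplexSubspace {I : LieIdeal ℝ L} {x : L} :
    x ∈ maximalComplexSubspace I ↔ x ∈ I ∧ Complex.I • x ∈ I := Iff.rfl

/-- A real subspace of odd dimension is not a complex subspace. -/
theorem exists_mem_I_smul_notMem {I : LieIdeal ℝ L} (hI : finrank ℝ I = 5) :
    ∃ e ∈ I, Complex.I • e ∉ I := by
  by_contra! h
  have h1 : ∀ x, x ∈ maximalComplexSubspace I ↔ x ∈ I := fun x =>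
    ⟨fun hx => hx.1, fun hx => ⟨hx, h x hx⟩⟩
  have h2 : (maximalComplexSubspace I).restrictScalars ℝ = I.toSubmodule := by
    ext x
    exact h1 x
  have h3 : finrank ℝ (maximalComplexSubspace I) = 5 := by
    rw [← hI]
    change finrank ℝ ((maximalComplexSubspace I).restrictScalars ℝ) = finrank ℝ I.toSubmodule
    rw [h2]
  have h4 : finrank ℝ ℂ * finrank ℂ (maximalComplexSubspace I) =
      finrank ℝ (maximalComplexSubspace I) := finrank_mul_finrank ℝ ℂ _
  rw [Complex.finrank_real_complex] at h4
  omega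

omit [Module ℂ L] [IsScalarTower ℝ ℂ L] in
theorem exists_smul_add_mem {I : LieIdeal ℝ L} (hL : finrank ℝ L = 6) (hI : finrank ℝ I = 5)
    {f : L} (hf : f ∉ I) (x : L) : ∃ s : ℝ, ∃ y ∈ I, x = s • f + y := by
  have : FiniteDimensional ℝ L := FiniteDimensional.of_finrank_pos (by omega)
  have hlt : I.toSubmodule < I.toSubmodule ⊔ Submodule.span ℝ {f} := by
    refine lt_of_le_of_ne le_sup_left fun h => hf ?_
    have : f ∈ I.toSubmodule ⊔ Submodule.span ℝ {f} :=
      Submodule.mem_sup_right (Submodule.mem_span_singleton_self f)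
    rw [← h] at this
    exact this
  have h1 := Submodule.finrank_lt_finrank_of_lt hlt
  have h2 : finrank ℝ I.toSubmodule = 5 := hI
  have h3 := Submodule.finrank_le (I.toSubmodule ⊔ Submodule.span ℝ {f})
  have htop := Submodule.eq_top_of_finrank_eq
    (show finrank ℝ ↥(I.toSubmodule ⊔ Submodule.span ℝ {f}) = finrank ℝ L by omega)
  have hx : x ∈ I.toSubmodule ⊔ Submodule.span ℝ {f} := htop ▸ Submodule.mem_top
  obtain ⟨y, hy, z, hz, rfl⟩ := Submodule.mem_sup.1 hx
  obtain ⟨s, rfl⟩ := Submodule.mem_span_singleton.1 hz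
  exact ⟨s, y, hy, add_comm _ _⟩

theorem exists_eq_smul_add_mem_maximalComplexSubspace {I : LieIdeal ℝ L} (hL : finrank ℝ L = 6)
    (hI : finrank ℝ I = 5) {e : L} (he : e ∈ I) (hie : Complex.I • e ∉ I) (x : L) :
    ∃ s t : ℝ, ∃ w ∈ maximalComplexSubspace I, x = s • (Complex.I • e) + t • e + w := by
  obtain ⟨s, y, hy, rfl⟩ := exists_smul_add_mem hL hI hie x
  obtain ⟨t, z, hz, hyz⟩ := exists_smul_add_mem hL hI hie (Complex.I • y)
  refine ⟨s, t, y - t • e, ⟨sub_mem hy (I.toSubmodule.smul_mem t he), ?_⟩, by abel⟩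
  rw [smul_sub, hyz, I_smul_real_smul, add_sub_cancel_left]
  exact hz

theorem finrank_maximalComplexSubspace {I : LieIdeal ℝ L} (hL : finrank ℝ L = 6)
    (hI : finrank ℝ I = 5) : finrank ℂ (maximalComplexSubspace I) = 2 := by
  obtain ⟨e, he, hie⟩ := exists_mem_I_smul_notMem hI
  have h4 : finrank ℝ ℂ * finrank ℂ L = finrank ℝ L := finrank_mul_finrank ℝ ℂ _
  rw [Complex.finrank_real_complex, hL] at h4
  have : FiniteDimensional ℂ L := FiniteDimensional.of_finrank_pos (by omega)
  have heW : e ∉ maximalComplexSubspace I := fun h => hie h.2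
  have he0 : e ≠ 0 := fun h => heW (h ▸ zero_mem _)
  have hc : IsCompl (maximalComplexSubspace I) (Submodule.span ℂ {e}) := by
    refine ⟨?_, ?_⟩
    · rw [Submodule.disjoint_span_singleton' he0]
      exact heW
    · rw [codisjoint_iff, eq_top_iff]
      intro x _
      obtain ⟨s, t, w, hw, rfl⟩ := exists_eq_smul_add_mem_maximalComplexSubspace hL hI he hie x
      refine add_mem (Submodule.mem_sup_right ?_) (Submodule.mem_sup_left hw)
      refine Submodule.mem_span_singleton.2 ⟨(s : ℂ) * Complex.I + t, ?_⟩
      rw [add_smul, mul_smul]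
      exact congrArg₂ (· + ·) (algebraMap_smul ℂ s _) (algebraMap_smul ℂ t _)
  have h5 := Submodule.finrank_add_eq_of_isCompl hc
  rw [finrank_span_singleton he0] at h5
  omega

/-- The structure of a Lie algebra with an abelian ideal `I` of codimension one and an integrable
complex structure, given as scalar multiplication by `Complex.I`: the largest complex subspace `W`
of `I` is invariant under `ad (i e)`, for any `e ∈ I`, and `ad (i e)` is complex linear on `W`;
choosing a normal form of it gives a basis in which the structure constants have one of four
shapes. -/
theorem exists_lieEquiv_modelMatrix_of_complex {I : LieIdeal ℝ L} (hab : IsLieAbelian I)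
    (hL : finrank ℝ L = 6) (hI : finrank ℝ I = 5)
    (hN : ∀ x y : L, ⁅Complex.I • x, Complex.I • y⁆ - Complex.I • ⁅Complex.I • x, y⁆
      - Complex.I • ⁅x, Complex.I • y⁆ - ⁅x, y⁆ = 0) :
    (∃ a x y x' y', Nonempty (L ≃ₗ⁅ℝ⁆ Alg (modelMatrix a x y x' y' 0 0 0))) ∨
    (∃ a x' y', Nonempty (L ≃ₗ⁅ℝ⁆ Alg (modelMatrix a a 0 x' y' 1 0 0))) ∨
    (∃ a x y, Nonempty (L ≃ₗ⁅ℝ⁆ Alg (modelMatrix a x y x y 0 0 1))) ∨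
    (∃ a, Nonempty (L ≃ₗ⁅ℝ⁆ Alg (modelMatrix a a 0 a 0 0 1 1))) := by
  obtain ⟨e, he, hie⟩ := exists_mem_I_smul_notMem hI
  have hcomm : ∀ {x y : L}, x ∈ I → y ∈ I → ⁅x, y⁆ = 0 := fun {x y} hx hy =>
    congrArg Subtype.val (hab.trivial ⟨x, hx⟩ ⟨y, hy⟩)
  -- Integrability on `e` and a vector of `W` says that `ad (i e)` commutes with `i` on `W`.
  have hI' : ∀ {y : L}, y ∈ maximalComplexSubspace I →
      ⁅Complex.I • e, Complex.I • y⁆ = Complex.I • ⁅Complex.I • e, y⁆ := by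
    intro y hy
    have h := hN e y
    rw [hcomm he hy.1, hcomm he hy.2, smul_zero, sub_zero, sub_zero] at h
    exact sub_eq_zero.1 h
  have hW : ∀ {y : L}, y ∈ maximalComplexSubspace I →
      ⁅Complex.I • e, y⁆ ∈ maximalComplexSubspace I := fun {y} hy =>
    ⟨lie_mem_right ℝ L I _ _ hy.1, hI' hy ▸ lie_mem_right ℝ L I _ _ hy.2⟩
  let T : maximalComplexSubspace I →ₗ[ℂ] maximalComplexSubspace I :=
    { toFun := fun y => ⟨⁅Complex.I • e, (y : L)⁆, hW y.2⟩
      map_add' := fun y z => Subtype.ext (lie_add _ _ _)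
      map_smul' := fun z y => Subtype.ext (by
        change ⁅Complex.I • e, z • (y : L)⁆ = z • ⁅Complex.I • e, (y : L)⁆
        rw [complex_smul_eq z (y : L), complex_smul_eq z ⁅_, _⁆, lie_add, lie_smul, lie_smul,
          hI' y.2]) }
  obtain ⟨s, a, v, hv, hev⟩ := exists_eq_smul_add_mem_maximalComplexSubspace hL hI he hie
    ⁅Complex.I • e, e⁆
  have hs : s = 0 := by
    by_contra hs
    have h1 : s • (Complex.I • e) ∈ I := by
      have h2 : s • (Complex.I • e) = ⁅Complex.I • e, e⁆ - a • e - v := by rw [hev]; abel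
      rw [h2]
      exact sub_mem (sub_mem (lie_mem_right ℝ L I _ _ he) (I.toSubmodule.smul_mem a he)) hv.1
    have h3 := I.toSubmodule.smul_mem s⁻¹ h1
    rw [smul_smul, inv_mul_cancel₀ hs, one_smul] at h3
    exact hie h3
  rw [hs, zero_smul, zero_add] at hev
  obtain ⟨x, u, w, l, m, hind, hform⟩ := exists_extension_normalForm
    (finrank_maximalComplexSubspace hL hI) T (a : ℂ) ⟨v, hv⟩
  have hind' : LinearIndependent ℂ ![e + (x : L), (u : L), (w : L)] := by
    have h1 : LinearIndependent ℂ ![(u : L), (w : L)] := by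
      have := hind.map' (maximalComplexSubspace I).subtype (Submodule.ker_subtype _)
      have hc : (maximalComplexSubspace I).subtype ∘ ![u, w] = ![(u : L), (w : L)] := by
        funext i
        fin_cases i <;> rfl
      rwa [hc] at this
    refine LinearIndependent.finCons h1 fun h2 => ?_
    have h3 : Submodule.span ℂ (Set.range ![(u : L), (w : L)]) ≤ maximalComplexSubspace I := by
      rw [Submodule.span_le]
      rintro _ ⟨i, rfl⟩
      fin_cases i
      exacts [u.2, w.2]
    have h4 := sub_mem (h3 h2) x.2
    rw [add_sub_cancel_right] at h4
    exact hie h4.2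
  -- Replacing `e` by `e + x` does not change `ad (i e)` on `I`.
  have hadd : ∀ {y : L}, y ∈ I → ⁅Complex.I • (e + (x : L)), y⁆ = ⁅Complex.I • e, y⁆ := by
    intro y hy
    rw [smul_add, add_lie, hcomm x.2.2 hy, add_zero]
  have hTx : ∀ y : maximalComplexSubspace I,
      ⁅Complex.I • (e + (x : L)), (y : L)⁆ = (T y : L) := fun y => hadd y.2.1
  have hTIx : ∀ y : maximalComplexSubspace I,
      ⁅Complex.I • (e + (x : L)), Complex.I • (y : L)⁆ = Complex.I • (T y : L) := fun y =>
    (hadd y.2.2).trans (hI' y.2)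
  have hee : ⁅Complex.I • (e + (x : L)), e + (x : L)⁆ =
      a • (e + (x : L)) + ((⟨v, hv⟩ + T x - (a : ℂ) • x : maximalComplexSubspace I) : L) := by
    rw [hadd (add_mem he x.2.1), lie_add, hev]
    change a • e + v + ⁅Complex.I • e, (x : L)⁆ =
      a • (e + (x : L)) + (v + ⁅Complex.I • e, (x : L)⁆ - (a : ℂ) • (x : L))
    rw [show (a : ℂ) • (x : L) = a • (x : L) from algebraMap_smul ℂ a (x : L)]
    module
  have model := @nonempty_lieEquiv_modelMatrix L _ _ _ _ I hab hL (e + (x : L)) u w hind'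
    (add_mem he x.2.1) u.2.1 u.2.2 w.2.1 w.2.2
  have hl : ∀ (z : ℂ) (y : L), Complex.I • z • y = -z.im • y + z.re • Complex.I • y := by
    intro z y
    rw [complex_smul_eq z, smul_add, I_smul_real_smul, I_smul_real_smul, I_smul_I_smul]
    module
  have ha : ∀ y : L, (a : ℂ) • y = a • y := fun y => algebraMap_smul ℂ a y
  rcases hform with ⟨hu, hw, h0⟩ | ⟨hu, hw, h0⟩ | ⟨hu, hw, h0⟩ | ⟨hu, hw, h0⟩
  · refine Or.inl ⟨a, l.re, l.im, m.re, m.im, model ?_ ?_ ?_ ?_ ?_⟩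
    · rw [hee, h0]
      simp
    · rw [hTx, hu]
      exact complex_smul_eq l _
    · rw [hTIx, hu]
      exact hl l _
    · rw [hTx, hw]
      refine (complex_smul_eq m _).trans ?_
      module
    · rw [hTIx, hw]
      refine (hl m _).trans ?_
      module
  · refine Or.inr (Or.inl ⟨a, m.re, m.im, model ?_ ?_ ?_ ?_ ?_⟩)
    · rw [hee, h0]
      module
    · rw [hTx, hu]
      refine (ha _).trans ?_
      module
    · rw [hTIx, hu]
      refine (congrArg _ (ha _)).trans ((I_smul_real_smul _ _).trans ?_)
      module
    · rw [hTx, hw]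
      refine (complex_smul_eq m _).trans ?_
      module
    · rw [hTIx, hw]
      refine (hl m _).trans ?_
      module
  · refine Or.inr (Or.inr (Or.inl ⟨a, l.re, l.im, model ?_ ?_ ?_ ?_ ?_⟩))
    · rw [hee, h0]
      simp
    · rw [hTx, hu]
      exact complex_smul_eq l _
    · rw [hTIx, hu]
      exact hl l _
    · rw [hTx, hw]
      refine (congrArg (· + (u : L)) (complex_smul_eq l _)).trans ?_
      module
    · rw [hTIx, hw]
      refine (smul_add Complex.I _ _).trans ((congrArg (· + Complex.I • (u : L)) (hl l _)).trans ?_)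
      module
  · refine Or.inr (Or.inr (Or.inr ⟨a, model ?_ ?_ ?_ ?_ ?_⟩))
    · rw [hee, h0]
      module
    · rw [hTx, hu]
      refine (ha _).trans ?_
      module
    · rw [hTIx, hu]
      refine (congrArg _ (ha _)).trans ((I_smul_real_smul _ _).trans ?_)
      module
    · rw [hTx, hw]
      refine (congrArg (· + (u : L)) (ha _)).trans ?_
      module
    · rw [hTIx, hw]
      refine (smul_add Complex.I _ _).trans ((congrArg (· + Complex.I • (u : L))
        ((congrArg _ (ha _)).trans (I_smul_real_smul _ _))).trans ?_)
      module

end ComplexScalars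

/-- The complex vector space structure given by a complex structure on a real Lie algebra. -/
abbrev IsComplexStructure.complexModule {L : Type*} [LieRing L] [LieAlgebra ℝ L]
    {J : L →ₗ[ℝ] L} (hJ : IsComplexStructure L J) : Module ℂ L :=
  Module.compHom L (Complex.lift ⟨(J : Module.End ℝ L), LinearMap.ext fun x => by
    simpa using hJ.sq_eq_neg x⟩ : ℂ →ₐ[ℝ] Module.End ℝ L).toRingHom

theorem exists_lieEquiv_modelMatrix {L : Type*} [LieRing L] [LieAlgebra ℝ L]
    (hL : finrank ℝ L = 6) (hab : IsAlmostAbelian L) {J : L →ₗ[ℝ] L}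
    (hJ : IsComplexStructure L J) :
    (∃ a x y x' y', Nonempty (L ≃ₗ⁅ℝ⁆ Alg (modelMatrix a x y x' y' 0 0 0))) ∨
    (∃ a x' y', Nonempty (L ≃ₗ⁅ℝ⁆ Alg (modelMatrix a a 0 x' y' 1 0 0))) ∨
    (∃ a x y, Nonempty (L ≃ₗ⁅ℝ⁆ Alg (modelMatrix a x y x y 0 0 1))) ∨
    (∃ a, Nonempty (L ≃ₗ⁅ℝ⁆ Alg (modelMatrix a a 0 a 0 0 1 1))) := by
  obtain ⟨I, hI, hfin⟩ := hab
  let := hJ.complexModule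
  have hz : ∀ (z : ℂ) (x : L), z • x = z.re • x + z.im • J x := fun z x => by
    change (Complex.lift _ z : Module.End ℝ L) x = _
    simp [Complex.lift, Complex.liftAux_apply]
  have : IsScalarTower ℝ ℂ L := ⟨fun r z x => by
    rw [hz, hz]
    simp [smul_smul]⟩
  have hi : ∀ x : L, Complex.I • x = J x := fun x => by rw [hz]; simp
  refine exists_lieEquiv_modelMatrix_of_complex hI hL (by omega) fun x y => ?_
  simp only [hi]
  exact hJ.nijenhuis_eq_zero x y

end AdaptedBasis

/-! ### Nilpotency, and isomorphisms given by monomial matrices -/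

section Isomorphisms

open Module

theorem Alg.adSix_smul {M : Matrix (Fin 5) (Fin 5) ℝ} (c : ℝ) (y : Alg M) :
    Alg.adSix (c • y) = c • Alg.adSix y := by
  refine funext fun i => ?_
  rw [Alg.smul_apply]
  fin_cases i <;> simp only [Alg.adSix_apply, Alg.smul_apply] <;> simp <;> ring

/-- If `ad f_6` is nilpotent then so is the Lie algebra, by Engel's theorem. -/
theorem isNilpotent_of_adSix_cube {L : Type*} [LieRing L] [LieAlgebra ℝ L]
    {M : Matrix (Fin 5) (Fin 5) ℝ} (e : L ≃ₗ⁅ℝ⁆ Alg M)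
    (h : ∀ y : Alg M, Alg.adSix (Alg.adSix (Alg.adSix y)) = 0) : LieRing.IsNilpotent L := by
  rw [e.nilpotent_iff_equiv_nilpotent]
  have : Module.Finite ℝ (Alg M) := inferInstanceAs (Module.Finite ℝ (Fin 6 → ℝ))
  rw [LieAlgebra.isNilpotent_iff_forall (R := ℝ)]
  intro x
  refine ⟨4, LinearMap.ext fun y => ?_⟩
  have h5 : ∀ z : Alg M, Alg.adSix z 5 = 0 := fun z => by simp [Alg.adSix_apply]
  have h1 : ∀ z : Alg M, z 5 = 0 → ⁅x, z⁆ = x 5 • Alg.adSix z := fun z hz => by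
    rw [Alg.lie_eq, hz, zero_smul, sub_zero]
  have h2 : (⁅x, y⁆ : Alg M) 5 = 0 := Alg.bracket_five x y
  have h3 : ∀ (c : ℝ) (z : Alg M), z 5 = 0 → (c • z) 5 = 0 := fun c z hz => by
    rw [Alg.smul_apply, hz, mul_zero]
  have h4 : Alg.adSix (Alg.adSix (Alg.adSix ⁅x, y⁆)) = 0 := h _
  change ⁅x, ⁅x, ⁅x, ⁅x, y⁆⁆⁆⁆ = 0
  rw [h1 _ h2, h1 _ (h3 _ _ (h5 _)), Alg.adSix_smul, h1 _ (h3 _ _ (h3 _ _ (h5 _))),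
    Alg.adSix_smul, Alg.adSix_smul, h4, smul_zero, smul_zero, smul_zero]

/-- `Alg M` is isomorphic to `Alg B` if `B` arises from `M` by rescaling `f_6` by `c`
and passing to the basis `d_j f_{σ j}` of the ideal spanned by `f_1, …, f_5`. -/
theorem nonempty_lieEquiv_of_monomial {M B : Matrix (Fin 5) (Fin 5) ℝ} (c : ℝ) (σ : Fin 5 → Fin 5)
    (d : Fin 5 → ℝ) (hσ : Function.Bijective σ) (hc : c ≠ 0) (hd : ∀ i, d i ≠ 0)
    (h : ∀ k j, c * M (σ k) (σ j) * d j = d k * B k j) : Nonempty (Alg M ≃ₗ⁅ℝ⁆ Alg B) := by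
  let v : Fin 6 → Alg M := Fin.snoc (α := fun _ => Alg M)
    (fun j : Fin 5 => d j • basisVec (σ j).castSucc) (c • basisVec 5)
  have hvj : ∀ j : Fin 5, v j.castSucc = d j • basisVec (σ j).castSucc := fun j => by
    simp only [v, Fin.snoc_castSucc]
  have hv5 : v 5 = c • basisVec 5 := Fin.snoc_last (α := fun _ => Alg M) _ _
  have h6 : ∀ k : Fin 5, (5 : Fin 6) ≠ k.castSucc := fun k => (Fin.castSucc_lt_last k).ne'
  have hsum : ∀ {n : ℕ} (x : Fin n → Alg M) (i : Fin 6), (∑ k, x k) i = ∑ k, x k i := fun x i =>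
    Finset.sum_apply i Finset.univ x
  have hv : LinearIndependent ℝ v := by
    rw [Fintype.linearIndependent_iff]
    intro g hg i
    have h1 : ∀ i : Fin 6,
        (∑ k : Fin 5, g k.castSucc * (d k * (if i = (σ k).castSucc then 1 else 0)))
        + g 5 * (c * (if i = 5 then 1 else 0)) = 0 := by
      intro i
      have h2 := congrFun hg i
      rw [hsum, Fin.sum_univ_castSucc] at h2
      simp only [Alg.smul_apply, hvj, basisVec_apply] at h2
      rw [show v (Fin.last 5) = _ from hv5] at h2
      simp only [Alg.smul_apply, basisVec_apply] at h2
      exact h2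
    induction i using Fin.lastCases with
    | last =>
      have h2 := h1 5
      simp [h6, hc] at h2
      exact h2
    | cast j =>
      have h2 := h1 (σ j).castSucc
      rw [if_neg (h6 _).symm, mul_zero, mul_zero, add_zero,
        Finset.sum_eq_single j (fun k _ hk => by
          rw [if_neg (fun h => hk (hσ.1 (Fin.castSucc_injective _ h)).symm), mul_zero, mul_zero])
          (fun h => absurd (Finset.mem_univ j) h)] at h2
      simpa [hd j] using h2
  have hfin : finrank ℝ (Alg M) = 6 := Module.finrank_fin_fun ℝ
  have hFin : Module.Finite ℝ (Alg M) := inferInstanceAs (Module.Finite ℝ (Fin 6 → ℝ))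
  let b : Basis (Fin 6) ℝ (Alg M) := basisOfLinearIndependentOfCardEqFinrank hv (by simp [hfin])
  have hb : ∀ i, b i = v i := fun i => by simp [b]
  refine nonempty_lieEquiv_alg b B (fun i j => ?_) (fun j => ?_)
  · rw [hb, hb, Alg.lie_eq, hvj, hvj, Alg.smul_apply, Alg.smul_apply, basisVec_apply,
      basisVec_apply, if_neg (h6 _), if_neg (h6 _), mul_zero, mul_zero, zero_smul, zero_smul,
      sub_zero]
  · simp only [hb]
    rw [Alg.lie_eq, hv5, hvj]
    refine Alg.ext_castSucc (fun i => ?_) ?_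
    · obtain ⟨i, rfl⟩ := hσ.2 i
      rw [hsum, Finset.sum_eq_single i (fun k _ hk => by
          rw [hvj, Alg.smul_apply, Alg.smul_apply, basisVec_apply,
            if_neg (fun h => hk (hσ.1 (Fin.castSucc_injective _ h)).symm), mul_zero, mul_zero])
          (fun h => absurd (Finset.mem_univ i) h)]
      rw [Alg.adSix_smul, Alg.sub_apply]
      simp only [Alg.smul_apply, Alg.adSix_single, hvj, basisVec_apply, if_neg (h6 _), if_true]
      have := h i j
      linear_combination this
    · rw [hsum]
      simp [hvj, Alg.smul_apply, Alg.sub_apply, basisVec_apply, Alg.adSix_apply, h6]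
      rfl

end Isomorphisms

/-! ### Matching the normal forms with the families -/

section Cases

-- The same list of nonvanishing hypotheses is used for all entries of a matrix.
set_option linter.unusedSimpArgs false

variable {a x y x' y' : ℝ}

theorem abs_div_le_one {s t : ℝ} (ht : t ≠ 0) (h : |s| ≤ |t|) : 1 ≥ |s / t| := by
  rw [abs_div]
  exact (div_le_one (abs_pos.2 ht)).2 h

theorem abs_div_lt_one {s t : ℝ} (ht : t ≠ 0) (h : |s| < |t|) : 1 > |s / t| := by
  rw [abs_div]
  exact (div_lt_one (abs_pos.2 ht)).2 h

theorem abs_div_le_abs_div {r s : ℝ} (t : ℝ) (h : |r| ≤ |s|) : |s / t| ≥ |r / t| := by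
  rw [abs_div, abs_div]
  exact div_le_div_of_nonneg_right h (abs_nonneg t)

theorem abs_div_lt_abs_div {r s t : ℝ} (ht : t ≠ 0) (h : |r| < |s|) : |s / t| > |r / t| := by
  rw [abs_div, abs_div]
  exact div_lt_div_of_pos_right h (abs_pos.2 ht)

theorem abs_div_pos {s t : ℝ} (hs : s ≠ 0) (ht : t ≠ 0) : |s / t| > 0 :=
  abs_pos.2 (div_ne_zero hs ht)

/-- The diagonalizable case with real eigenvalues `a, x, x, x', x'`: the eigenvalue of largest
absolute value is scaled to `1`. -/
theorem exists_family_of_diagonal_real (h : a ≠ 0 ∨ x ≠ 0) (hle : |x'| ≤ |x|) :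
    ∃ k : Family, k.InRange ∧
      Nonempty (Alg (modelMatrix a x 0 x' 0 0 0 0) ≃ₗ⁅ℝ⁆ k.algebra) := by
  by_cases hx : x = 0
  · have hx' : x' = 0 := by simpa [hx] using hle
    have ha : a ≠ 0 := h.resolve_right (not_not.2 hx)
    refine ⟨.k13, trivial,
      nonempty_lieEquiv_of_monomial (1 / a) ![0, 1, 2, 3, 4] ![1, 1, 1, 1, 1] (by decide)
        (one_div_ne_zero ha) (by simp [Fin.forall_fin_succ]) fun k j => ?_⟩
    fin_cases k <;> fin_cases j <;> simp [modelMatrix, Family.coeff, ha, hx, hx']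
  by_cases hx' : x' = 0
  · by_cases ha : a = 0
    · refine ⟨.k14, trivial,
        nonempty_lieEquiv_of_monomial (1 / x) ![1, 2, 0, 3, 4] ![1, 1, 1, 1, 1] (by decide)
          (one_div_ne_zero hx) (by simp [Fin.forall_fin_succ]) fun k j => ?_⟩
      fin_cases k <;> fin_cases j <;> simp [modelMatrix, Family.coeff, ha, hx, hx']
    by_cases hax : |x| ≤ |a|
    · refine ⟨.k17 (x / a), ⟨abs_div_le_one ha hax, abs_div_pos hx ha⟩,
        nonempty_lieEquiv_of_monomial (1 / a) ![0, 1, 2, 3, 4] ![1, 1, 1, 1, 1] (by decide)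
          (one_div_ne_zero ha) (by simp [Fin.forall_fin_succ]) fun k j => ?_⟩
      fin_cases k <;> fin_cases j <;> simp [modelMatrix, Family.coeff, ha, hx, hx'] <;> field_simp
    · refine ⟨.k18 (a / x), ⟨abs_div_lt_one hx (not_le.1 hax), abs_div_pos ha hx⟩,
        nonempty_lieEquiv_of_monomial (1 / x) ![1, 2, 0, 3, 4] ![1, 1, 1, 1, 1] (by decide)
          (one_div_ne_zero hx) (by simp [Fin.forall_fin_succ]) fun k j => ?_⟩
      fin_cases k <;> fin_cases j <;> simp [modelMatrix, Family.coeff, ha, hx, hx']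
      field_simp
  by_cases hax : |x| ≤ |a|
  · have ha : a ≠ 0 := abs_pos.1 ((abs_pos.2 hx).trans_le hax)
    refine ⟨.k1 (x / a) (x' / a), ⟨abs_div_le_one ha hax, abs_div_le_abs_div a hle,
      abs_div_pos hx' ha⟩,
      nonempty_lieEquiv_of_monomial (1 / a) ![0, 1, 2, 3, 4] ![1, 1, 1, 1, 1] (by decide)
        (one_div_ne_zero ha) (by simp [Fin.forall_fin_succ]) fun k j => ?_⟩
    fin_cases k <;> fin_cases j <;> simp [modelMatrix, Family.coeff, ha, hx, hx'] <;> field_simp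
  by_cases hax' : |x'| ≤ |a|
  · have ha : a ≠ 0 := abs_pos.1 ((abs_pos.2 hx').trans_le hax')
    refine ⟨.k2 (a / x) (x' / x),
      ⟨abs_div_lt_one hx (not_le.1 hax), abs_div_le_abs_div x hax', abs_div_pos hx' hx⟩,
      nonempty_lieEquiv_of_monomial (1 / x) ![1, 2, 0, 3, 4] ![1, 1, 1, 1, 1] (by decide)
        (one_div_ne_zero hx) (by simp [Fin.forall_fin_succ]) fun k j => ?_⟩
    fin_cases k <;> fin_cases j <;> simp [modelMatrix, Family.coeff, ha, hx, hx'] <;> field_simp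
  by_cases ha : a = 0
  · refine ⟨.k20 (x' / x), ⟨abs_div_le_one hx hle, abs_div_pos hx' hx⟩,
      nonempty_lieEquiv_of_monomial (1 / x) ![1, 2, 3, 4, 0] ![1, 1, 1, 1, 1] (by decide)
        (one_div_ne_zero hx) (by simp [Fin.forall_fin_succ]) fun k j => ?_⟩
    fin_cases k <;> fin_cases j <;> simp [modelMatrix, Family.coeff, ha, hx, hx'] <;> field_simp
  · refine ⟨.k3 (x' / x) (a / x),
      ⟨abs_div_le_one hx hle, abs_div_lt_abs_div hx (not_le.1 hax'), abs_div_pos ha hx⟩,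
      nonempty_lieEquiv_of_monomial (1 / x) ![1, 2, 3, 4, 0] ![1, 1, 1, 1, 1] (by decide)
        (one_div_ne_zero hx) (by simp [Fin.forall_fin_succ]) fun k j => ?_⟩
    fin_cases k <;> fin_cases j <;> simp [modelMatrix, Family.coeff, ha, hx, hx'] <;> field_simp

/-- The diagonalizable case with eigenvalues `a, x, x` and a pair `x' ± i y'`: the imaginary part is
scaled to `1`, or `x` is if `a = 0`. -/
theorem exists_family_of_diagonal_mixed (hy' : y' ≠ 0) :
    ∃ k : Family, k.InRange ∧
      Nonempty (Alg (modelMatrix a x 0 x' y' 0 0 0) ≃ₗ⁅ℝ⁆ k.algebra) := by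
  have hy'' : -y' ≠ 0 := neg_ne_zero.2 hy'
  by_cases ha : a = 0
  · by_cases hx : x = 0
    · refine ⟨.k15 (x' / -y'), trivial,
        nonempty_lieEquiv_of_monomial (1 / -y') ![3, 4, 0, 1, 2] ![1, 1, 1, 1, 1] (by decide)
          (one_div_ne_zero hy'') (by simp [Fin.forall_fin_succ]) fun k j => ?_⟩
      fin_cases k <;> fin_cases j <;> simp [modelMatrix, Family.coeff, ha, hx, hy'] <;> field_simp
    · refine ⟨.k22 (x' / x) (-y' / x), div_ne_zero hy'' hx,
        nonempty_lieEquiv_of_monomial (1 / x) ![1, 2, 3, 4, 0] ![1, 1, 1, 1, 1] (by decide)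
          (one_div_ne_zero hx) (by simp [Fin.forall_fin_succ]) fun k j => ?_⟩
      fin_cases k <;> fin_cases j <;> simp [modelMatrix, Family.coeff, ha, hx, hy'] <;> field_simp
  by_cases hx : x = 0
  · refine ⟨.k19 (a / -y') (x' / -y'), div_ne_zero ha hy'',
      nonempty_lieEquiv_of_monomial (1 / -y') ![0, 3, 4, 1, 2] ![1, 1, 1, 1, 1] (by decide)
        (one_div_ne_zero hy'') (by simp [Fin.forall_fin_succ]) fun k j => ?_⟩
    fin_cases k <;> fin_cases j <;> simp [modelMatrix, Family.coeff, ha, hx, hy'] <;> field_simp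
  by_cases hax : |x| ≤ |a|
  · refine ⟨.k8 (a / -y') (x / -y') (x' / -y'), ⟨abs_div_le_abs_div _ hax, abs_div_pos hx hy''⟩,
      nonempty_lieEquiv_of_monomial (1 / -y') ![0, 1, 2, 3, 4] ![1, 1, 1, 1, 1] (by decide)
        (one_div_ne_zero hy'') (by simp [Fin.forall_fin_succ]) fun k j => ?_⟩
    fin_cases k <;> fin_cases j <;> simp [modelMatrix, Family.coeff, ha, hx, hy'] <;> field_simp
  · refine ⟨.k9 (x / -y') (a / -y') (x' / -y'),
      ⟨abs_div_lt_abs_div hy'' (not_le.1 hax), abs_div_pos ha hy''⟩,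
      nonempty_lieEquiv_of_monomial (1 / -y') ![1, 2, 0, 3, 4] ![1, 1, 1, 1, 1] (by decide)
        (one_div_ne_zero hy'') (by simp [Fin.forall_fin_succ]) fun k j => ?_⟩
    fin_cases k <;> fin_cases j <;> simp [modelMatrix, Family.coeff, ha, hx, hy'] <;> field_simp

/-- The diagonalizable case with eigenvalue `a` and two pairs `x ± i y` and `x' ± i y'`. -/
theorem exists_family_of_diagonal_complex (hy : y ≠ 0) (hy' : y' ≠ 0)
    (h : |x| > |x'| ∨ |x| = |x'| ∧ |y'| ≤ |y|) :
    ∃ k : Family, k.InRange ∧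
      Nonempty (Alg (modelMatrix a x y x' y' 0 0 0) ≃ₗ⁅ℝ⁆ k.algebra) := by
  have hn : -y ≠ 0 := neg_ne_zero.2 hy
  have hrange : |x / -y| > |x' / -y| ∨ |x / -y| = |x' / -y| ∧ |y' / y| ≤ 1 := by
    rcases h with h | ⟨h, h'⟩
    · exact Or.inl (abs_div_lt_abs_div hn h)
    · exact Or.inr ⟨by rw [abs_div, abs_div, h], abs_div_le_one hy h'⟩
  by_cases ha : a = 0
  · refine ⟨.k25 (x / -y) (x' / -y) (y' / y), ⟨div_ne_zero hy' hy, hrange⟩,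
      nonempty_lieEquiv_of_monomial (1 / -y) ![1, 2, 3, 4, 0] ![1, 1, 1, 1, 1] (by decide)
        (one_div_ne_zero hn) (by simp [Fin.forall_fin_succ]) fun k j => ?_⟩
    fin_cases k <;> fin_cases j <;> simp [modelMatrix, Family.coeff, ha, hy] <;> field_simp
  · refine ⟨.k11 (a / -y) (x / -y) (x' / -y) (y' / y),
      ⟨mul_ne_zero (div_ne_zero ha hn) (div_ne_zero hy' hy), hrange⟩,
      nonempty_lieEquiv_of_monomial (1 / -y) ![0, 1, 2, 3, 4] ![1, 1, 1, 1, 1] (by decide)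
        (one_div_ne_zero hn) (by simp [Fin.forall_fin_succ]) fun k j => ?_⟩
    fin_cases k <;> fin_cases j <;> simp [modelMatrix, Family.coeff, ha, hy] <;> field_simp

/-- The case of a Jordan block of size two with real eigenvalue `a` which is not contained in the
complex subspace. As `f_6` is rescaled by `c`, so is the vector `u = [f_6, e] - a e`, in order that
the entry `1` of the Jordan block is kept. -/
theorem exists_family_of_real_jordan (h : a ≠ 0 ∨ x' ≠ 0 ∨ y' ≠ 0) :
    ∃ k : Family, k.InRange ∧
      Nonempty (Alg (modelMatrix a a 0 x' y' 1 0 0) ≃ₗ⁅ℝ⁆ k.algebra) := by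
  by_cases hy' : y' = 0
  · by_cases ha : a = 0
    · have hx' : x' ≠ 0 := (h.resolve_left (not_not.2 ha)).resolve_right (not_not.2 hy')
      refine ⟨.k21, trivial,
        nonempty_lieEquiv_of_monomial (1 / x') ![3, 4, 1, 0, 2] ![1, 1, 1 / x', 1, 1] (by decide)
          (one_div_ne_zero hx') (by simp [Fin.forall_fin_succ, hx']) fun k j => ?_⟩
      fin_cases k <;> fin_cases j <;> simp [modelMatrix, Family.coeff, ha, hx', hy']
    by_cases hx' : x' = 0
    · refine ⟨.k16, trivial,
        nonempty_lieEquiv_of_monomial (1 / a) ![2, 1, 0, 3, 4] ![1, 1 / a, 1, 1, 1] (by decide)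
          (one_div_ne_zero ha) (by simp [Fin.forall_fin_succ, ha]) fun k j => ?_⟩
      fin_cases k <;> fin_cases j <;> simp [modelMatrix, Family.coeff, ha, hx', hy']
    by_cases hax : |x'| ≤ |a|
    · refine ⟨.k4 (x' / a), ⟨abs_div_le_one ha hax, abs_div_pos hx' ha⟩,
        nonempty_lieEquiv_of_monomial (1 / a) ![2, 1, 0, 3, 4] ![1, 1 / a, 1, 1, 1] (by decide)
          (one_div_ne_zero ha) (by simp [Fin.forall_fin_succ, ha]) fun k j => ?_⟩
      fin_cases k <;> fin_cases j <;> simp [modelMatrix, Family.coeff, ha, hx', hy'] <;> field_simp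
    · refine ⟨.k5 (a / x'), ⟨abs_div_lt_one hx' (not_le.1 hax), abs_div_pos ha hx'⟩,
        nonempty_lieEquiv_of_monomial (1 / x') ![3, 1, 0, 4, 2] ![1, 1 / x', 1, 1, 1] (by decide)
          (one_div_ne_zero hx') (by simp [Fin.forall_fin_succ, hx']) fun k j => ?_⟩
      fin_cases k <;> fin_cases j <;> simp [modelMatrix, Family.coeff, ha, hx', hy'] <;> field_simp
  have hy'' : -y' ≠ 0 := neg_ne_zero.2 hy'
  by_cases ha : a = 0
  · refine ⟨.k23 (x' / -y'), trivial,
      nonempty_lieEquiv_of_monomial (1 / -y') ![3, 4, 1, 0, 2] ![1, 1, 1 / -y', 1, 1] (by decide)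
        (one_div_ne_zero hy'') (by simp [Fin.forall_fin_succ, hy']) fun k j => ?_⟩
    fin_cases k <;> fin_cases j <;> simp [modelMatrix, Family.coeff, ha, hy'] <;> field_simp
  · refine ⟨.k10 (a / -y') (x' / -y'), div_ne_zero ha hy'',
      nonempty_lieEquiv_of_monomial (1 / -y') ![2, 1, 0, 3, 4] ![1, 1 / -y', 1, 1, 1] (by decide)
        (one_div_ne_zero hy'') (by simp [Fin.forall_fin_succ, hy']) fun k j => ?_⟩
    fin_cases k <;> fin_cases j <;> simp [modelMatrix, Family.coeff, ha, hy'] <;> field_simp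

/-- The case of a complex Jordan block on the complex subspace, which splits off.
In `k12` and `k26` the off-diagonal part of the block is minus the identity, so `u` and `i u` are
rescaled by `-c` there, where `c` is the factor of `f_6`. -/
theorem exists_family_of_complex_jordan (h : a ≠ 0 ∨ x ≠ 0 ∨ y ≠ 0) :
    ∃ k : Family, k.InRange ∧
      Nonempty (Alg (modelMatrix a x y x y 0 0 1) ≃ₗ⁅ℝ⁆ k.algebra) := by
  by_cases hy : y = 0
  · by_cases ha : a = 0
    · have hx : x ≠ 0 := (h.resolve_left (not_not.2 ha)).resolve_right (not_not.2 hy)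
      refine ⟨.k24, trivial,
        nonempty_lieEquiv_of_monomial (1 / x) ![1, 3, 2, 4, 0] ![1 / x, 1, 1 / x, 1, 1] (by decide)
          (one_div_ne_zero hx) (by simp [Fin.forall_fin_succ, hx]) fun k j => ?_⟩
      fin_cases k <;> fin_cases j <;> simp [modelMatrix, Family.coeff, ha, hx, hy]
    · refine ⟨.k6 (x / a), trivial,
        nonempty_lieEquiv_of_monomial (1 / a) ![0, 1, 3, 2, 4] ![1, 1 / a, 1, 1 / a, 1] (by decide)
          (one_div_ne_zero ha) (by simp [Fin.forall_fin_succ, ha]) fun k j => ?_⟩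
      fin_cases k <;> fin_cases j <;> simp [modelMatrix, Family.coeff, ha, hy] <;> field_simp
  have hn : -y ≠ 0 := neg_ne_zero.2 hy
  by_cases ha : a = 0
  · refine ⟨.k26 (x / -y), trivial,
      nonempty_lieEquiv_of_monomial (1 / -y) ![1, 2, 3, 4, 0] ![1 / y, 1 / y, 1, 1, 1] (by decide)
        (one_div_ne_zero hn) (by simp [Fin.forall_fin_succ, hy]) fun k j => ?_⟩
    fin_cases k <;> fin_cases j <;> simp [modelMatrix, Family.coeff, ha, hy] <;> field_simp
  · refine ⟨.k12 (a / -y) (x / -y), div_ne_zero ha hn,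
      nonempty_lieEquiv_of_monomial (1 / -y) ![0, 1, 2, 3, 4] ![1, 1 / y, 1 / y, 1, 1] (by decide)
        (one_div_ne_zero hn) (by simp [Fin.forall_fin_succ, hy]) fun k j => ?_⟩
    fin_cases k <;> fin_cases j <;> simp [modelMatrix, Family.coeff, ha, hy] <;> field_simp

/-- The case of a Jordan block of size three which is not contained in the complex subspace. -/
theorem exists_family_of_long_jordan (ha : a ≠ 0) :
    ∃ k : Family, k.InRange ∧
      Nonempty (Alg (modelMatrix a a 0 a 0 0 1 1) ≃ₗ⁅ℝ⁆ k.algebra) := by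
  refine ⟨.k7 a, ha,
    nonempty_lieEquiv_of_monomial 1 ![1, 3, 0, 2, 4] ![1, 1, 1, 1, 1] (by decide)
      one_ne_zero (by simp [Fin.forall_fin_succ]) fun k j => ?_⟩
  fin_cases k <;> fin_cases j <;> simp [modelMatrix, Family.coeff, ha]

end Cases

/-! ### Classification of the Lie algebras -/

section Classification

open Module

theorem nonempty_lieEquiv_modelMatrix_swap (a x y x' y' : ℝ) :
    Nonempty (Alg (modelMatrix a x y x' y' 0 0 0) ≃ₗ⁅ℝ⁆ Alg (modelMatrix a x' y' x y 0 0 0)) := by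
  refine nonempty_lieEquiv_of_monomial 1 ![0, 3, 4, 1, 2] ![1, 1, 1, 1, 1] (by decide)
    one_ne_zero (by simp [Fin.forall_fin_succ]) fun k j => ?_
  fin_cases k <;> fin_cases j <;> simp [modelMatrix]

theorem exists_family_of_diagonal {a x y x' y' : ℝ}
    (h : ¬(a = 0 ∧ x = 0 ∧ y = 0 ∧ x' = 0 ∧ y' = 0)) :
    ∃ k : Family, k.InRange ∧
      Nonempty (Alg (modelMatrix a x y x' y' 0 0 0) ≃ₗ⁅ℝ⁆ k.algebra) := by
  obtain ⟨e⟩ := nonempty_lieEquiv_modelMatrix_swap a x y x' y'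
  by_cases hy : y = 0
  · by_cases hy' : y' = 0
    · subst hy hy'
      rcases le_total |x'| |x| with hle | hle
      · refine exists_family_of_diagonal_real ?_ hle
        by_contra! h0
        exact h ⟨h0.1, h0.2, rfl, by simpa [h0.2] using hle, rfl⟩
      · obtain ⟨k, hk, ⟨f⟩⟩ := exists_family_of_diagonal_real (a := a) (x := x') (x' := x) (by
          by_contra! h0
          exact h ⟨h0.1, by simpa [h0.2] using hle, rfl, h0.2, rfl⟩) hle
        exact ⟨k, hk, ⟨e.trans f⟩⟩
    · subst hy
      exact exists_family_of_diagonal_mixed hy'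
  · by_cases hy' : y' = 0
    · subst hy'
      obtain ⟨k, hk, ⟨f⟩⟩ := exists_family_of_diagonal_mixed (a := a) (x := x') (x' := x) hy
      exact ⟨k, hk, ⟨e.trans f⟩⟩
    · by_cases h1 : |x| > |x'| ∨ |x| = |x'| ∧ |y'| ≤ |y|
      · exact exists_family_of_diagonal_complex hy hy' h1
      · have h2 : |x'| > |x| ∨ |x'| = |x| ∧ |y| ≤ |y'| := by
          push Not at h1
          rcases lt_or_eq_of_le h1.1 with h3 | h3
          · exact Or.inl h3
          · exact Or.inr ⟨h3.symm, (h1.2 h3).le⟩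
        obtain ⟨k, hk, ⟨f⟩⟩ := exists_family_of_diagonal_complex (a := a) hy' hy h2
        exact ⟨k, hk, ⟨e.trans f⟩⟩

/-- A non-nilpotent six-dimensional almost abelian Lie algebra with a complex structure belongs to
one of the 26 families. -/
theorem exists_family_of_isComplexStructure {L : Type*} [LieRing L] [LieAlgebra ℝ L]
    (hL : finrank ℝ L = 6) (hab : IsAlmostAbelian L) (hnil : ¬ LieRing.IsNilpotent L)
    {J : L →ₗ[ℝ] L} (hJ : IsComplexStructure L J) :
    ∃ k : Family, k.InRange ∧ Nonempty (L ≃ₗ⁅ℝ⁆ k.algebra) := by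
  have htrans : ∀ {M : Matrix (Fin 5) (Fin 5) ℝ}, (L ≃ₗ⁅ℝ⁆ Alg M) →
      (∃ k : Family, k.InRange ∧ Nonempty (Alg M ≃ₗ⁅ℝ⁆ k.algebra)) →
      ∃ k : Family, k.InRange ∧ Nonempty (L ≃ₗ⁅ℝ⁆ k.algebra) :=
    fun e ⟨k, hk, ⟨f⟩⟩ => ⟨k, hk, ⟨e.trans f⟩⟩
  rcases exists_lieEquiv_modelMatrix hL hab hJ with
    ⟨a, x, y, x', y', ⟨e⟩⟩ | ⟨a, x', y', ⟨e⟩⟩ | ⟨a, x, y, ⟨e⟩⟩ | ⟨a, ⟨e⟩⟩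
  · refine htrans e (exists_family_of_diagonal ?_)
    rintro ⟨rfl, rfl, rfl, rfl, rfl⟩
    refine hnil (isNilpotent_of_adSix_cube e fun v => funext fun i => ?_)
    change _ = (0 : ℝ)
    fin_cases i <;> simp only [Alg.adSix_apply] <;> simp [modelMatrix]
  · refine htrans e (exists_family_of_real_jordan ?_)
    by_contra! h
    obtain ⟨rfl, rfl, rfl⟩ := h
    refine hnil (isNilpotent_of_adSix_cube e fun v => funext fun i => ?_)
    change _ = (0 : ℝ)
    fin_cases i <;> simp only [Alg.adSix_apply] <;> simp [modelMatrix]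
  · refine htrans e (exists_family_of_complex_jordan ?_)
    by_contra! h
    obtain ⟨rfl, rfl, rfl⟩ := h
    refine hnil (isNilpotent_of_adSix_cube e fun v => funext fun i => ?_)
    change _ = (0 : ℝ)
    fin_cases i <;> simp only [Alg.adSix_apply] <;> simp [modelMatrix]
  · refine htrans e (exists_family_of_long_jordan ?_)
    rintro rfl
    refine hnil (isNilpotent_of_adSix_cube e fun v => funext fun i => ?_)
    change _ = (0 : ℝ)
    fin_cases i <;> simp only [Alg.adSix_apply] <;> simp [modelMatrix]

theorem IsComplexStructure.of_lieEquiv {L L' : Type*} [LieRing L] [LieAlgebra ℝ L] [LieRing L']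
    [LieAlgebra ℝ L'] (e : L ≃ₗ⁅ℝ⁆ L') {J : L' →ₗ[ℝ] L'} (hJ : IsComplexStructure L' J) :
    IsComplexStructure L ((e.symm : L' →ₗ[ℝ] L) ∘ₗ J ∘ₗ (e : L →ₗ[ℝ] L')) := by
  have h : ∀ x, ((e.symm : L' →ₗ[ℝ] L) ∘ₗ J ∘ₗ (e : L →ₗ[ℝ] L')) x = e.symm (J (e x)) :=
    fun x => rfl
  constructor
  · intro x
    rw [h, h, e.apply_symm_apply, hJ.sq_eq_neg, map_neg, e.symm_apply_apply]
  · intro x y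
    obtain ⟨p, rfl⟩ : ∃ p, e.symm p = x := ⟨e x, e.symm_apply_apply x⟩
    obtain ⟨q, rfl⟩ : ∃ q, e.symm q = y := ⟨e y, e.symm_apply_apply y⟩
    have hb : ∀ p q : L', ⁅e.symm p, e.symm q⁆ = e.symm ⁅p, q⁆ := fun p q =>
      (LieEquiv.map_lie e.symm p q).symm
    simp only [h, e.apply_symm_apply, hb]
    rw [← map_sub, ← map_sub, ← map_sub, hJ.nijenhuis_eq_zero, map_zero]

end Classification

end

end AlmostAbelianSix

theorem theorem3p2 :
    (∀ (G : Type*) [TopologicalSpace G] [ChartedSpace (EuclideanSpace ℝ (Fin 6)) G] [Group G]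
        [LieGroup (𝓡 6) ∞ G] [SimplyConnectedSpace G],
        AlmostAbelianSix.IsAlmostAbelian (GroupLieAlgebra (𝓡 6) G) →
        ¬ LieRing.IsNilpotent (GroupLieAlgebra (𝓡 6) G) →
        ((∃ J : ∀ g : G, TangentSpace (𝓡 6) g →ₗ[ℝ] TangentSpace (𝓡 6) g,
            AlmostAbelianSix.IsLeftInvariantComplexStructure G J) ↔
          ∃ k : AlmostAbelianSix.Family, k.InRange ∧
            Nonempty (GroupLieAlgebra (𝓡 6) G ≃ₗ⁅ℝ⁆ k.algebra))) ∧
    (∀ k : AlmostAbelianSix.Family, k.InRange →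
        AlmostAbelianSix.IsComplexStructure k.algebra k.complexStructure) := by
  refine ⟨fun G _ _ _ _ _ hab hnil => ?_, fun k _ => k.isComplexStructure⟩
  rw [AlmostAbelianSix.exists_isLeftInvariantComplexStructure_iff]
  constructor
  · rintro ⟨J, hJ⟩
    have hL : Module.finrank ℝ (GroupLieAlgebra (𝓡 6) G) = 6 :=
      (finrank_euclideanSpace_fin : Module.finrank ℝ (EuclideanSpace ℝ (Fin 6)) = 6)
    exact AlmostAbelianSix.exists_family_of_isComplexStructure hL hab hnil hJ
  · rintro ⟨k, -, ⟨e⟩⟩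
    exact ⟨_, k.isComplexStructure.of_lieEquiv e⟩
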